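/- Let $b,n$ be positive integers. Let $b^{<n}$ be the set of all sequences with entries in $\{0,\dots,b-1\}$ of length less than $n$, let $|s|$ be the length of $s$, let $\sqsubseteq$ be the initial segment ordering on $b^{<n}$ and let $\le_{\mathrm{lex}}$ be the lexicographical order on $b^{<n}$ (that is, $s\le_{\mathrm{lex}}t$ if $s\sqsubseteq t$, or if at the first position where $s$ and $t$ differ the entry of $s$ is smaller than the entry of $t$). For $S\subseteq b^{<n}$ and $s\in S$ let $h_S(s)$ be the number of $t\in S$ with $t\sqsubset s$, and let $\mathrm{ImSucc}_S(s)$ be the set of all $t\in S$ with $s\sqsubset t$ such that no $t'\in S$ satisfies $s\sqsubset t'\sqsubset t$. For a positive integer $k$, a set $S\subseteq b^{<n}$ is a $k$-complete skew subtree of $b^{<n}$ if (i) $S$ has a minimum with respect to $\sqsubseteq$, and every $\sqsubseteq$-maximal chain of $S$ has cardinality $k$; (ii) $|s|\le|s'|$ for all $s,s'\in S$ with $h_S(s)=h_S(s')$ and $s\le_{\mathrm{lex}}s'$; (iii) $|s|<|s'|$ for all $s,s'\in S$ with $h_S(s)<h_S(s')$; (iv) for every $s\in S$ that is not $\sqsubseteq$-maximal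 in $S$ and every $i\in\{0,\dots,b-1\}$ there is a unique $t\in\mathrm{ImSucc}_S(s)$ with $s^\smallfrown(i)\sqsubseteq t$. Let $\mathcal U_k(b^{<n})$ be the set of all collections $\mathbf U=(U_t)_{t\in T}$ of pairwise disjoint subsets of $b^{<n}$, where $T$ is a $k$-complete skew subtree of $b^{<n}$ and, for every $t\in T$, the set $U_t$ has minimum $t$ with respect to $\sqsubseteq$. For $\mathbf U\in\mathcal U_m(b^{<n})$ let $\mathcal U_k(\mathbf U)$ be the set of all $\mathbf V\in\mathcal U_k(b^{<n})$ such that every member of $\mathbf V$ is a union of members of $\mathbf U$. **Theorem.** Let $k,m,b,r$ be positive integers with $k\le m$. Then there exists a positive integer $n_0$ with the following property. For every integer $n\ge n_0$ and every coloring of $\mathcal U_k(b^{<n})$ with $r$ colors, there exists $\mathbf U\in\mathcal U_m(b^{<n})$ such that the set $\mathcal U_k(\mathbf U)$ is monochromatic. -/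

import Mathlib

/-- `TreeNode b n` is the tree `b^{<n}`: the set of all finite sequences with entries in
`{0, ..., b-1}` and length less than `n`. -/
@[ext]
structure TreeNode (b n : ℕ) where
  /-- the underlying sequence -/
  seq : List (Fin b)
  length_lt : seq.length < n

namespace TreeNode

variable {b n : ℕ}

/-- The initial segment ordering: `s ≤ t` means that `s` is an initial segment of `t`
(and `s < t` that it is a proper one). -/
instance instPartialOrder : PartialOrder (TreeNode b n) where
  le s t := s.seq <+: t.seq
  le_refl s := List.prefix_refl s.seq
  le_trans _ _ _ h₁ h₂ := h₁.trans h₂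
  le_antisymm _ _ h₁ h₂ := TreeNode.ext (h₁.eq_of_length_le h₂.length_le)

/-- The length `|s|` of a node. -/
def len (s : TreeNode b n) : ℕ := s.seq.length

/-- The lexicographical order: `s` is an initial segment of `t`, or at the first position where
they differ the entry of `s` is smaller than the entry of `t`. -/
def LexLE (s t : TreeNode b n) : Prop :=
  s ≤ t ∨ ∃ (p u v : List (Fin b)) (i j : Fin b),
    s.seq = p ++ i :: u ∧ t.seq = p ++ j :: v ∧ i < j

/-- The height of `s` in the subtree `S`: the number of proper predecessors of `s` in `S`. -/
noncomputable def heightIn (S : Set (TreeNode b n)) (s : TreeNode b n) : ℕ :=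
  {t | t ∈ S ∧ t < s}.ncard

/-- The set of immediate successors of `s` in the subtree `S`. -/
def immSucc (S : Set (TreeNode b n)) (s : TreeNode b n) : Set (TreeNode b n) :=
  {t | t ∈ S ∧ s < t ∧ ¬ ∃ t' ∈ S, s < t' ∧ t' < t}

/-- `S` is a `k`-complete skew subtree of `b^{<n}`. -/
structure IsCompleteSkew (k : ℕ) (S : Set (TreeNode b n)) : Prop where
  /-- `S` has a minimum. -/
  exists_root : ∃ t, IsLeast S t
  /-- Every maximal chain of `S` has cardinality `k`. -/
  ncard_maxChain : ∀ C : Set (TreeNode b n),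
    Maximal (fun D : Set (TreeNode b n) => D ⊆ S ∧ IsChain (· ≤ ·) D) C → C.ncard = k
  /-- On each level of `S` lengths are non-decreasing in the lexicographical order. -/
  len_le_of_lex : ∀ s ∈ S, ∀ s' ∈ S,
    heightIn S s = heightIn S s' → LexLE s s' → s.len ≤ s'.len
  /-- Nodes on lower levels of `S` are strictly shorter than nodes on higher levels. -/
  len_lt_of_height_lt : ∀ s ∈ S, ∀ s' ∈ S,
    heightIn S s < heightIn S s' → s.len < s'.len
  /-- Each non-maximal node of `S` has exactly one immediate successor in each direction. -/
  existsUnique_immSucc : ∀ s ∈ S, ¬ Maximal (· ∈ S) s → ∀ i : Fin b,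
    ∃! t, t ∈ immSucc S s ∧ s.seq ++ [i] <+: t.seq

/-- The set `U_k(b^{<n})` of all collections `(U_t)_{t ∈ T}` of pairwise disjoint subsets of
`b^{<n}`, where `T` is a `k`-complete skew subtree and each `U_t` has minimum `t`. As `t` can be
read off from `U_t`, such a collection is given by the set of its members. -/
def families (k b n : ℕ) : Set (Set (Set (TreeNode b n))) :=
  {𝒰 | ∃ (T : Set (TreeNode b n)) (U : TreeNode b n → Set (TreeNode b n)),
    IsCompleteSkew k T ∧ (∀ t ∈ T, IsLeast (U t) t) ∧ T.PairwiseDisjoint U ∧ 𝒰 = U '' T}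

/-- `𝒱` is a subspace of `𝒰`: every member of `𝒱` is a union of members of `𝒰`. -/
def IsSubspace (𝒱 𝒰 : Set (Set (TreeNode b n))) : Prop :=
  ∀ V ∈ 𝒱, ∃ 𝒜 ⊆ 𝒰, V = ⋃₀ 𝒜

/-- The set `U_k(𝒰)` of all subspaces of `𝒰` that belong to `U_k(b^{<n})`. -/
def subspaces (k : ℕ) (𝒰 : Set (Set (TreeNode b n))) : Set (Set (Set (TreeNode b n))) :=
  {𝒱 | 𝒱 ∈ families k b n ∧ IsSubspace 𝒱 𝒰}

end TreeNode

/-! A member of `families k b n` is encoded by a partial labelling of the tree by `TreeNode b k`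
whose classes have minima given by a skew embedding. A subspace of the family of a labelling `U` is
then `U` followed by a reduction `v` (`exists_isReduction_of_mem_subspaces`), so it suffices to find
`U` for which all these composites have one colour (`exists_monochromatic_labelling`).

Two Ramsey statements carry this. The tree part is `exists_offThread_invariant`: the tree is thinned
to classes such that the colour does not change when labels are deleted on an up-set, provided that
each deleted label repeats the label of a predecessor outside the up-set. Hence the colour sees a
labelling only on the threads leading to the minima of its classes. The classes are built one node
at a time (`exists_placement`); a combinatorial line makes a new class whose label is already
available below it indistinguishable from an unlabelled one.

What remains, on the threads, is one-dimensional. A word whose letters are types of levels (`Level`)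
describes a tree with labels along its threads (`thread`, `threadLabel`): a level either places a
node, or is a buffer in which one front of threads moves in some direction with some label. The
types are ordered so that every reduction induces a rigid word (`IsReduction.rigidWord_levelMap`),
and substituting it into a word `W` gives the threads and on-thread labels that the reduction
selects from `W` (`IsReduction.thread_eq`, `IsReduction.threadLabel_eq`). The Graham–Rothschild
theorem for words of levels then makes all colours equal. It follows from Ramsey's theorem and a
word version of the deletion principle, `exists_label_invariant_classes`. -/

open Function

/-! ### Hales–Jewett, Ramsey and Graham–Rothschild for words. -/

theorem exists_monochromatic_line (Λ C : Type) [Finite Λ] [Finite C] :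
    ∃ h : ℕ, ∀ c : (Fin h → Λ) → C, ∃ (s : Fin h → Option Λ) (l₀ : Fin h), s l₀ = none ∧
      (∀ l, s l = none → l₀ ≤ l) ∧
      ∀ x y, c (fun l => (s l).getD x) = c (fun l => (s l).getD y) := by
  classical
  obtain ⟨ι, hι, H⟩ := Combinatorics.Line.exists_mono_in_high_dimension Λ C
  refine ⟨Fintype.card ι, fun c => ?_⟩
  obtain ⟨L, i, hL⟩ := H (fun x => c (x ∘ (Fintype.equivFin ι).symm))
  set s : Fin (Fintype.card ι) → Option Λ := L.idxFun ∘ (Fintype.equivFin ι).symm with hs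
  have hne : ((Finset.univ : Finset (Fin (Fintype.card ι))).filter (s · = none)).Nonempty := by
    obtain ⟨j, hj⟩ := L.proper
    exact ⟨Fintype.equivFin ι j, by simp [hs, hj]⟩
  refine ⟨s, Finset.min' _ hne, ?_, fun l hl => Finset.min'_le _ _ (by simp [hl]), fun x y => ?_⟩
  · simpa using Finset.min'_mem _ hne
  · exact (hL x).trans (hL y).symm

/-- Finite Ramsey theorem for sets of a given size. -/
theorem exists_homogeneous_subset (C : Type) [Finite C] (K M : ℕ) :
    ∃ N : ℕ, ∀ (c : Finset ℕ → C) (X : Finset ℕ), N ≤ X.card →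
      ∃ B ⊆ X, B.card = M ∧ ∃ i, ∀ A ⊆ B, A.card = K → c A = i := by
  classical
  induction K generalizing M with
  | zero =>
    refine ⟨M, fun c X hX => ?_⟩
    obtain ⟨B, hB, hc⟩ := Finset.exists_subset_card_eq hX
    refine ⟨B, hB, hc, c ∅, fun A _ hA => ?_⟩
    rw [Finset.card_eq_zero.1 hA]
  | succ K ih =>
    have key : ∀ t : ℕ, ∃ N : ℕ, ∀ (c : Finset ℕ → C) (X : Finset ℕ), N ≤ X.card →
        ∃ B ⊆ X, B.card = t ∧ ∃ d : ℕ → C, ∀ A ⊆ B, A.card = K + 1 →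
          ∀ x ∈ A, (∀ y ∈ A, x ≤ y) → c A = d x := by
      intro t
      induction t with
      | zero =>
        refine ⟨0, fun c X _ => ⟨∅, by simp, rfl, fun _ => c ∅, fun A hA hc => ?_⟩⟩
        rw [Finset.subset_empty.1 hA] at hc
        simp at hc
      | succ t iht =>
        obtain ⟨Nt, hNt⟩ := iht
        obtain ⟨N, hN⟩ := ih Nt
        refine ⟨N + 1, fun c X hX => ?_⟩
        have hne : X.Nonempty := Finset.card_pos.1 (by omega)
        set x := X.min' hne with hx
        have hxX : x ∈ X := Finset.min'_mem _ _
        obtain ⟨X', hX', hc', i, hi⟩ := hN (fun A => c (insert x A)) (X.erase x)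
          (by rw [Finset.card_erase_of_mem hxX]; omega)
        obtain ⟨B, hB, hcB, d, hd⟩ := hNt c X' hc'.ge
        have hlt : ∀ y ∈ X', x < y := fun y hy => by
          have := hX' hy
          rw [Finset.mem_erase] at this
          exact lt_of_le_of_ne (Finset.min'_le _ _ this.2) this.1.symm
        have hxB : x ∉ B := fun h => lt_irrefl _ (hlt x (hB h))
        refine ⟨insert x B, ?_, by rw [Finset.card_insert_of_notMem hxB, hcB],
          update d x i, fun A hA hcA y hy hmin => ?_⟩
        · intro y hy
          rcases Finset.mem_insert.1 hy with rfl | hy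
          · exact hxX
          · exact Finset.mem_of_mem_erase (hX' (hB hy))
        · by_cases hxA : x ∈ A
          · have hyx : y = x := by
              rcases Finset.mem_insert.1 (hA hy) with h | h
              · exact h
              · exact absurd (hmin x hxA) (not_le.2 (hlt y (hB h)))
            rw [hyx, update_self]
            have := hi (A.erase x) (fun z hz => ?_)
              (by rw [Finset.card_erase_of_mem hxA]; omega)
            · rwa [Finset.insert_erase hxA] at this
            · rw [Finset.mem_erase] at hz
              exact hB ((Finset.mem_insert.1 (hA hz.2)).resolve_left hz.1)
          · have hAB : A ⊆ B := fun z hz =>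
              (Finset.mem_insert.1 (hA hz)).resolve_left (fun h => hxA (h ▸ hz))
            rw [update_of_ne (fun h : y = x => hxA (h ▸ hy))]
            exact hd A hAB hcA y hy hmin
    have := Fintype.ofFinite C
    obtain ⟨N, hN⟩ := key (Fintype.card C * M + 1)
    refine ⟨N, fun c X hX => ?_⟩
    obtain ⟨B, hB, hcB, d, hd⟩ := hN c X hX
    obtain ⟨i, -, hi⟩ := Finset.exists_lt_card_fiber_of_mul_lt_card_of_maps_to
      (s := B) (t := (Finset.univ : Finset C)) (f := d) (n := M) (fun _ _ => Finset.mem_univ _)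
      (by rw [hcB, Finset.card_univ]; omega)
    obtain ⟨B', hB', hcB'⟩ := Finset.exists_subset_card_eq hi.le
    have hsub : B' ⊆ B := hB'.trans (Finset.filter_subset _ _)
    refine ⟨B', hsub.trans hB, hcB', i, fun A hA hcA => ?_⟩
    have hne : A.Nonempty := Finset.card_pos.1 (by omega)
    rw [hd A (hA.trans hsub) hcA (A.min' hne) (Finset.min'_mem _ _)
      (fun y hy => Finset.min'_le _ _ hy)]
    exact (Finset.mem_filter.1 (hB' (hA (Finset.min'_mem _ _)))).2

/-- In a long enough interval one can find `N` disjoint nonempty classes, with increasing minima,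
such that a colouring of words does not see whether a class is unlabelled or carries the label of
an earlier class. -/
theorem exists_label_invariant_classes (κ : Type) [Finite κ] (N : ℕ) :
    ∀ (C : Type) [Finite C], ∃ n : ℕ, ∀ c : (ℕ → Option κ) → C,
      ∃ (U : ℕ → Option ℕ) (f : ℕ → ℕ),
        (∀ z q, U z = some q → q < N ∧ f q ≤ z ∧ z < n) ∧ (∀ q < N, U (f q) = some q) ∧
        (∀ p q, p < q → q < N → f p < f q) ∧
        ∀ (v : ℕ → Option κ) (i q : ℕ), i < q → q < N →
          c (fun z => (U z).bind (update v q none)) =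
            c (fun z => (U z).bind (update v q (v i))) := by
  induction N with
  | zero => exact fun C _ => ⟨0, fun c => ⟨fun _ => none, id, by simp, by simp, by simp, by simp⟩⟩
  | succ N ih =>
    intro C _
    -- The colours for the first `N` classes record the final colour as a function of the label of
    -- class `N`.
    obtain ⟨n, hn⟩ := ih (Option κ → C)
    -- A letter copies the label of a position below `n`, or is blank. Colouring a point by its
    -- colours under all labellings of those positions makes one line serve them all.
    obtain ⟨h, hh⟩ := exists_monochromatic_line (Option (Fin n)) ((Fin n → Option κ) → C)
    refine ⟨n + h, fun c => ?_⟩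
    let word : (ℕ → Option κ) → (Fin h → Option κ) → ℕ → Option κ := fun u x z =>
      if z < n then u z else if hz : z - n < h then x ⟨z - n, hz⟩ else none
    obtain ⟨s, l₀, hl₀, hmin, hs⟩ := hh (fun x w =>
      c (word (fun z => if hz : z < n then w ⟨z, hz⟩ else none) (fun l => (x l).bind w)))
    let wd : (ℕ → Option κ) → Option κ → ℕ → Option κ := fun u γ =>
      word u (fun l => (s l).elim γ (fun a => a.bind (fun i => u i)))
    have hwd : ∀ u (a : Option (Fin n)), c (wd u (a.bind fun i => u i)) = c (wd u none) := by
      intro u a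
      have := congrFun (hs a none) (fun i => u i)
      convert this using 2
      · funext z
        simp only [wd, word]
        split_ifs with h1 h2
        · rfl
        · cases s ⟨z - n, h2⟩ <;> simp
        · rfl
      · funext z
        simp only [wd, word]
        split_ifs with h1 h2
        · rfl
        · cases s ⟨z - n, h2⟩ <;> simp
        · rfl
    obtain ⟨U₀, f₀, hU₀, hUf₀, hf₀, hinv₀⟩ := hn (fun u γ => c (wd u γ))
    -- Wildcards form class `N`; a position with a constant letter joins the class of the position
    -- it copies.
    let U : ℕ → Option ℕ := fun z => if z < n then U₀ z else
      if hz : z - n < h then (s ⟨z - n, hz⟩).elim (some N) (fun a => a.bind (fun i => U₀ i))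
      else none
    have hcomp : ∀ v : ℕ → Option κ,
        (fun z => (U z).bind v) = wd (fun z => (U₀ z).bind v) (v N) := by
      intro v
      funext z
      simp only [wd, word, U]
      split_ifs with h1 h2
      · rfl
      · cases s ⟨z - n, h2⟩ <;> simp [Option.bind_assoc]
      · rfl
    have hUN : ∀ (v : ℕ → Option κ) γ,
        (fun z => (U₀ z).bind (update v N γ)) = fun z => (U₀ z).bind v := by
      intro v γ
      funext z
      cases hz : U₀ z with
      | none => rfl
      | some q =>
        simp only [Option.bind_some]
        exact update_of_ne (hU₀ z q hz).1.ne _ _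
    refine ⟨U, fun q => if q < N then f₀ q else n + l₀, ?_, ?_, ?_, ?_⟩
    · intro z q hz
      simp only [U] at hz
      split_ifs at hz with h1 h2
      · obtain ⟨a, b, e⟩ := hU₀ z q hz
        simp only [a, if_true]
        omega
      · cases hsz : s ⟨z - n, h2⟩ with
        | none =>
          simp only [hsz, Option.elim_none, Option.some.injEq] at hz
          subst hz
          have := hmin _ hsz
          simp only [Fin.le_def] at this
          simp
          omega
        | some a =>
          simp only [hsz, Option.elim_some, Option.bind_eq_some_iff] at hz
          obtain ⟨i, -, hi⟩ := hz
          obtain ⟨a, b, e⟩ := hU₀ _ q hi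
          simp only [a, if_true]
          omega
    · intro q hq
      by_cases hqN : q < N
      · have := hUf₀ q hqN
        have h2 := hU₀ _ _ this
        simp [hqN, U, h2.2.2, this]
      · have : q = N := by omega
        subst this
        simp [U, hl₀]
    · intro p q hpq hq
      have hp : p < N := by omega
      simp only [hp, if_true]
      split_ifs with hqN
      · exact hf₀ p q hpq hqN
      · have := (hU₀ _ _ (hUf₀ p hp)).2.2
        omega
    · intro v i q hiq hq
      rw [hcomp, hcomp]
      by_cases hqN : q < N
      · rw [update_of_ne hqN.ne', update_of_ne hqN.ne']
        exact congrFun (hinv₀ v i q hiq hqN) (v N)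
      · have : q = N := by omega
        subst this
        rw [hUN, hUN, update_self, update_self]
        -- Giving class `N` the label of class `i` is the point of the line with letter `f₀ i`;
        -- leaving it unlabelled is the point with the blank letter.
        have hfi := hUf₀ i hiq
        have := hwd (fun z => (U₀ z).bind v) (some ⟨f₀ i, (hU₀ _ _ hfi).2.2⟩)
        simp only [Option.bind_some, hfi] at this
        exact this.symm

/-- A word in the letters `β` (and a blank) is rigid if every letter occurs, and the letters occur
for the first time in increasing order. -/
structure RigidWord {α β : Type*} [LT α] [LT β] (v : α → Option β) : Prop where
  surj : ∀ x, ∃ l, v l = some x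
  initial : ∀ l x y, v l = some y → x < y → ∃ l' < l, v l' = some x

open Classical in
/-- The word in which every letter `x` occurs exactly once, in position `a x`. -/
noncomputable def sparseWord {β : Type*} (a : β → ℕ) (q : ℕ) : Option β :=
  if h : ∃ x, a x = q then some h.choose else none

theorem sparseWord_apply {β : Type*} {a : β → ℕ} (ha : Injective a) (x : β) :
    sparseWord a (a x) = some x := by
  have h : ∃ y, a y = a x := ⟨x, rfl⟩
  rw [sparseWord, dif_pos h, ha h.choose_spec]

theorem sparseWord_eq_some {β : Type*} {a : β → ℕ} {q : ℕ} {x : β}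
    (h : sparseWord a q = some x) : a x = q := by
  unfold sparseWord at h
  split_ifs at h with hq
  rw [← Option.some.inj h]
  exact hq.choose_spec

/-- The **Graham–Rothschild theorem** for words with a single constant letter. -/
theorem graham_rothschild (β γ C : Type) [LinearOrder β] [Fintype β] [LinearOrder γ] [Fintype γ]
    [Finite C] : ∃ n : ℕ, ∀ c : (ℕ → Option β) → C, ∃ W : ℕ → Option γ, RigidWord W ∧
      (∀ l, W l ≠ none → l < n) ∧ ∃ i, ∀ v : γ → Option β, RigidWord v →
        c (fun l => (W l).bind v) = i := by
  classical
  obtain ⟨N, hN⟩ := exists_homogeneous_subset C (Fintype.card β) (Fintype.card γ)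
  obtain ⟨n, hn⟩ := exists_label_invariant_classes β N C
  refine ⟨n, fun c => ?_⟩
  obtain ⟨U, f, hU, hUf, hf, hinv⟩ := hn c
  -- Deleting labels one class at a time never touches the sources of the repeated labels, since
  -- these lie outside `D`; so `hinv` applies at each step.
  have hclean : ∀ (D : Finset ℕ) (v : ℕ → Option β),
      (∀ q ∈ D, q < N ∧ (v q = none ∨ ∃ i < q, i ∉ D ∧ v q = v i)) →
      c (fun z => (U z).bind v) = c (fun z => (U z).bind fun q => if q ∈ D then none else v q) := by
    intro D v
    induction D using Finset.induction_on with
    | empty => simp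
    | insert q D hq ih =>
      intro hD
      rw [ih (fun p hp => ⟨(hD p (Finset.mem_insert_of_mem hp)).1, ?_⟩)]
      · have e1 : (fun p => if p ∈ insert q D then none else v p) =
            update (fun p => if p ∈ D then none else v p) q none := by
          funext p
          by_cases hp : p = q
          · subst hp; simp
          · simp [hp]
        obtain ⟨hqN, h0 | ⟨i, hi, hiD, hvi⟩⟩ := hD q (Finset.mem_insert_self _ _)
        · congr 1
          funext z
          congr 1
          funext p
          by_cases hp : p = q
          · subst hp; simp [h0]
          · simp [hp]
        · rw [e1, hinv _ i q hi hqN]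
          congr 1
          funext z
          congr 1
          funext p
          rw [Finset.mem_insert, not_or] at hiD
          by_cases hp : p = q
          · subst hp; simp [hq, hiD.2, hvi]
          · simp [hp]
      · rcases (hD p (Finset.mem_insert_of_mem hp)).2 with h | ⟨i, hi, hiD, hvi⟩
        · exact Or.inl h
        · exact Or.inr ⟨i, hi, fun h => hiD (Finset.mem_insert_of_mem h), hvi⟩
  -- A set `A` stands for the word in which each letter labels exactly one class, the classes in `A`
  -- being used in increasing order.
  let cR : Finset ℕ → C := fun A =>
    if h : ∃ a : β → ℕ, StrictMono a ∧ Set.range a = A then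
      c (fun z => (U z).bind (sparseWord h.choose)) else c (fun _ => none)
  obtain ⟨B, hBX, hBc, i, hi⟩ := hN cR (Finset.range N) (by simp)
  let e : γ ≃o Fin (Fintype.card γ) := (Fintype.orderIsoFinOfCardEq γ rfl).symm
  let b : γ → ℕ := fun x => B.orderEmbOfFin hBc (e x)
  have hb : StrictMono b := fun x y hxy => (B.orderEmbOfFin hBc).strictMono (e.strictMono hxy)
  have hbB : ∀ x, b x ∈ B := fun x => Finset.orderEmbOfFin_mem _ _ _
  have hbN : ∀ x, b x < N := fun x => Finset.mem_range.1 (hBX (hbB x))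
  have hWf : ∀ x, (U (f (b x))).bind (sparseWord b) = some x := fun x => by
    rw [hUf _ (hbN x), Option.bind_some, sparseWord_apply hb.injective]
  refine ⟨fun z => (U z).bind (sparseWord b), ⟨fun x => ⟨_, hWf x⟩, ?_⟩, ?_, i, ?_⟩
  · intro l x y hl hxy
    obtain ⟨q, hq, hqy⟩ := Option.bind_eq_some_iff.1 hl
    rw [← sparseWord_eq_some hqy] at hq
    exact ⟨f (b x), (hf _ _ (hb hxy) (hbN y)).trans_le (hU _ _ hq).2.1, hWf x⟩
  · intro l hl
    obtain ⟨x, hx⟩ := Option.ne_none_iff_exists'.1 hl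
    obtain ⟨q, hq, -⟩ := Option.bind_eq_some_iff.1 hx
    exact (hU _ _ hq).2.2
  · intro v hv
    have hfirst : ∀ x, ∃ l, v l = some x ∧ ∀ l', v l' = some x → l ≤ l' := fun x => by
      have hne : ((Finset.univ : Finset γ).filter (v · = some x)).Nonempty := by
        obtain ⟨l, hl⟩ := hv.surj x
        exact ⟨l, by simp [hl]⟩
      exact ⟨Finset.min' _ hne, by simpa using Finset.min'_mem _ hne,
        fun l' hl' => Finset.min'_le _ _ (by simp [hl'])⟩
    choose ψ hψ hψmin using hfirst
    have hψmono : StrictMono ψ := fun x y hxy => by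
      obtain ⟨l, hl, hlx⟩ := hv.initial _ _ _ (hψ y) hxy
      exact (hψmin x l hlx).trans_lt hl
    set a : β → ℕ := b ∘ ψ with ha
    have hamono : StrictMono a := hb.comp hψmono
    set V : ℕ → Option β := fun q => (sparseWord b q).bind v with hV
    have hVa : ∀ x, V (a x) = some x := fun x => by
      simp [hV, ha, sparseWord_apply hb.injective, hψ]
    have h1 : (fun l => ((U l).bind (sparseWord b)).bind v) = fun l => (U l).bind V := by
      funext l
      rw [Option.bind_assoc]
    show c (fun l => ((U l).bind (sparseWord b)).bind v) = i
    -- A class outside the range of `a` is blank or repeats a letter that occurs earlier, so only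
    -- the set of first occurrences matters.
    rw [h1, hclean ((Finset.range N).filter fun q => ∀ x, a x ≠ q) V]
    · have h2 : (fun z => (U z).bind fun q =>
          if q ∈ (Finset.range N).filter (fun q => ∀ x, a x ≠ q) then none else V q) =
          fun z => (U z).bind (sparseWord a) := by
        funext z
        cases hz : U z with
        | none => rfl
        | some q =>
          simp only [Option.bind_some, Finset.mem_filter, Finset.mem_range, (hU z q hz).1,
            true_and]
          split_ifs with hq
          · unfold sparseWord
            rw [dif_neg]
            rintro ⟨x, hx⟩
            exact hq x hx
          · push Not at hq
            obtain ⟨x, rfl⟩ := hq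
            rw [sparseWord_apply hamono.injective, hVa]
      rw [h2]
      have hrange : ∃ a' : β → ℕ, StrictMono a' ∧
          Set.range a' = ((Finset.univ.image a : Finset ℕ) : Set ℕ) := ⟨a, hamono, by simp⟩
      have h3 := hi (Finset.univ.image a) (fun q hq => by
        obtain ⟨x, -, rfl⟩ := Finset.mem_image.1 hq
        exact hbB _) (by rw [Finset.card_image_of_injective _ hamono.injective, Finset.card_univ])
      simp only [cR, dif_pos hrange] at h3
      have h4 : hrange.choose = a := by
        refine (StrictMono.range_inj hrange.choose_spec.1 hamono).1 ?_
        rw [hrange.choose_spec.2]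
        simp
      rwa [h4] at h3
    · intro q hq
      rw [Finset.mem_filter, Finset.mem_range] at hq
      refine ⟨hq.1, ?_⟩
      cases hVq : V q with
      | none => exact Or.inl rfl
      | some x =>
        right
        refine ⟨a x, lt_of_le_of_ne ?_ (hq.2 x), by simp, (hVa x).symm⟩
        obtain ⟨l, hl, hlx⟩ := Option.bind_eq_some_iff.1 hVq
        rw [← sparseWord_eq_some hl]
        exact hb.monotone (hψmin x l hlx)

/-! ### Words on trees: placing nodes above their threads. -/

/-- The nodes of the infinite `b`-ary tree, ordered by `<+:`. -/
abbrev Node (b : ℕ) := List (Fin b)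

namespace Node

variable {b : ℕ}

instance finite_length_lt (n : ℕ) : Finite {s : Node b // s.length < n} :=
  (List.finite_length_lt (Fin b) n).to_subtype

instance finite_length_eq (n : ℕ) : Finite {s : Node b // s.length = n} :=
  (List.finite_length_eq (Fin b) n).to_subtype

/-- `θ` sends every node of `l` to a node of length `n`, in such a way that two nodes have the same
image exactly if they have a common predecessor in `l`. -/
structure IsThreading (l : List (Node b)) (n : ℕ) (θ : Node b → Node b) : Prop where
  length_eq : ∀ x ∈ l, (θ x).length = n
  eq_of_prefix : ∀ x ∈ l, ∀ u ∈ l, x <+: u → θ x = θ u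
  exists_prefix : ∀ x ∈ l, ∀ u ∈ l, θ x = θ u → ∃ y ∈ l, y <+: x ∧ y <+: u

/-- Extend a word `w` on the nodes of length less than `n`: the other nodes get, according to `U`,
the label in `w` of a node, or the label in `v` of an abstract node, or no label. -/
def extendWord {κ : Type} (n : ℕ) (U : Node b → Option (Node b ⊕ Node b))
    (w v : Node b → Option κ) (z : Node b) : Option κ :=
  if z.length < n then w z else (U z).bind (Sum.elim w v)

theorem extendWord_congr {κ : Type} {n : ℕ} {U : Node b → Option (Node b ⊕ Node b)}
    {w v v' : Node b → Option κ} (h : ∀ z x, U z = some (Sum.inr x) → v x = v' x) :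
    extendWord n U w v = extendWord n U w v' := by
  funext z
  unfold extendWord
  split_ifs
  · rfl
  · cases hz : U z with
    | none => rfl
    | some t =>
      cases t with
      | inl i => rfl
      | inr x => simpa using h z x hz

open Classical in
/-- The labels of the nodes in `D` are deleted. -/
noncomputable def deleteOn {κ : Type} (D : Set (Node b)) (v : Node b → Option κ) (u : Node b) :
    Option κ :=
  if u ∈ D then none else v u

/-- For every threading `θ`, the classes `U θ` with minima `f θ` place the abstract nodes of `l`
above their threads, between the levels `n` and `S`, and the colouring `c` does not see certain
labels on up-sets. -/
structure Placement {κ C : Type} (c : (Node b → Option κ) → C) (l : List (Node b)) (n S : ℕ)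
    (U : (Node b → Node b) → Node b → Option (Node b ⊕ Node b))
    (f : (Node b → Node b) → Node b → Node b) : Prop where
  inl_spec : ∀ θ, IsThreading l n θ → ∀ z i, U θ z = some (Sum.inl i) → i.length < n ∧ i <+: z
  inr_spec : ∀ θ, IsThreading l n θ → ∀ z x, U θ z = some (Sum.inr x) → x ∈ l ∧ f θ x <+: z
  min_spec : ∀ θ, IsThreading l n θ → ∀ x ∈ l, U θ (f θ x) = some (Sum.inr x) ∧ θ x <+: f θ x
  child_spec : ∀ θ, IsThreading l n θ → ∀ x ∈ l, ∀ a, x ++ [a] ∈ l →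
    f θ x ++ [a] <+: f θ (x ++ [a])
  pairwise : ∀ θ, IsThreading l n θ → l.Pairwise fun u w => (f θ u).length < (f θ w).length
  length_lt : ∀ θ, IsThreading l n θ → ∀ z, U θ z ≠ none → z.length < S
  congr : ∀ θ θ', IsThreading l n θ → IsThreading l n θ' →
    ∀ w v : Node b → Option κ,
    (∀ x ∈ l, v x ≠ none → θ x = θ' x) → extendWord n (U θ) w v = extendWord n (U θ') w v
  invariant : ∀ θ, IsThreading l n θ → ∀ (w v : Node b → Option κ) (D : Set (Node b)),
    (∀ u ∈ D, ∀ u', u <+: u' → u' ∈ D) →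
    (∀ u ∈ D, u ∈ l → v u = none ∨ (∃ i, i.length < n ∧ i <+: θ u ∧ v u = w i) ∨
      ∃ i ∈ l, i <+: u ∧ i ∉ D ∧ v u = v i) →
    c (extendWord n (U θ) w v) = c (extendWord n (U θ) w (deleteOn D v))

theorem exists_append_prefix {x u : Node b} (h : x <+: u) (hne : x ≠ u) :
    ∃ a, x ++ [a] <+: u := by
  obtain ⟨t, rfl⟩ := h
  cases t with
  | nil => simp at hne
  | cons a t => exact ⟨a, t, by simp⟩

variable [NeZero b]

/-- The threading obtained after the first node `x` of the list has been placed `l₀` steps above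
its thread; all threads are prolonged by `h` steps. -/
def nextThreading (x : Node b) (h l₀ : ℕ) (θ : Node b → Node b) (u : Node b) : Node b :=
  if x <+: u then
    θ x ++ List.replicate l₀ 0 ++ u.getD x.length 0 :: List.replicate (h - 1 - l₀) 0
  else θ u ++ List.replicate h 0

theorem getD_of_append_prefix {x u : Node b} {a : Fin b} (h : x ++ [a] <+: u) :
    u.getD x.length 0 = a := by
  obtain ⟨t, rfl⟩ := h
  simp

/-- Above `x`, threads differ exactly by the direction taken after `x`, and nodes with the same
direction `a` share `x ++ [a]`, which `hconv` puts into `l`. A node not above `x` was already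
separated from `x` by `θ`, because no other member of the list lies below `x`. -/
theorem IsThreading.next {x : Node b} {l : List (Node b)} {n h l₀ : ℕ} {θ : Node b → Node b}
    (hθ : IsThreading (x :: l) n θ) (hx : ∀ u ∈ l, ¬ u <+: x)
    (hconv : ∀ u ∈ l, ∀ a, x ++ [a] <+: u → x ++ [a] ∈ l) (hl₀ : l₀ < h) :
    IsThreading l (n + h) (nextThreading x h l₀ θ) := by
  have hxm : x ∈ x :: l := List.mem_cons_self
  have hm : ∀ u ∈ l, u ∈ x :: l := fun u hu => List.mem_cons_of_mem _ hu
  have hne : ∀ u ∈ l, x ≠ u := fun u hu e => hx u hu (e ▸ List.prefix_rfl)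
  refine ⟨fun u hu => ?_, fun u hu w hw huw => ?_, fun u hu w hw huw => ?_⟩
  · unfold nextThreading
    split_ifs
    · simp only [List.length_append, hθ.length_eq x hxm, List.length_replicate, List.length_cons]
      omega
    · simp [hθ.length_eq u (hm u hu)]
  · unfold nextThreading
    by_cases hxu : x <+: u
    · rw [if_pos hxu, if_pos (hxu.trans huw)]
      obtain ⟨a, ha⟩ := exists_append_prefix hxu (hne u hu)
      rw [getD_of_append_prefix ha, getD_of_append_prefix (ha.trans huw)]
    · have hxw : ¬ x <+: w := fun hxw => by
        rcases List.prefix_or_prefix_of_prefix hxw huw with h | h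
        · exact hxu h
        · exact hx u hu h
      rw [if_neg hxu, if_neg hxw, hθ.eq_of_prefix u (hm u hu) w (hm w hw) huw]
  · have haux : ∀ u ∈ l, ∀ w ∈ l, x <+: u → ¬ x <+: w →
        nextThreading x h l₀ θ u ≠ nextThreading x h l₀ θ w := by
      intro u hu w hw hxu hxw e
      unfold nextThreading at e
      rw [if_pos hxu, if_neg hxw, List.append_assoc] at e
      have e1 : θ x = θ w := List.append_inj_left e
        (by rw [hθ.length_eq x hxm, hθ.length_eq w (hm w hw)])
      obtain ⟨y, hy, hyx, hyw⟩ := hθ.exists_prefix x hxm w (hm w hw) e1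
      rcases List.mem_cons.1 hy with rfl | hy
      · exact hxw hyw
      · exact hx y hy hyx
    by_cases hxu : x <+: u <;> by_cases hxw : x <+: w
    · obtain ⟨a, ha⟩ := exists_append_prefix hxu (hne u hu)
      obtain ⟨a', ha'⟩ := exists_append_prefix hxw (hne w hw)
      unfold nextThreading at huw
      rw [if_pos hxu, if_pos hxw, getD_of_append_prefix ha, getD_of_append_prefix ha'] at huw
      have : a = a' := by simpa using huw
      subst this
      exact ⟨x ++ [a], hconv u hu a ha, ha, ha'⟩
    · exact absurd huw (haux u hu w hw hxu hxw)
    · exact absurd huw.symm (haux w hw u hu hxw hxu)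
    · unfold nextThreading at huw
      rw [if_neg hxu, if_neg hxw] at huw
      obtain ⟨y, hy, hyu, hyw⟩ := hθ.exists_prefix u (hm u hu) w (hm w hw)
        (List.append_cancel_right huw)
      rcases List.mem_cons.1 hy with rfl | hy
      · exact absurd hyu hxu
      · exact ⟨y, hy, hyu, hyw⟩

theorem IsThreading.prefix_next {x : Node b} {l : List (Node b)} {n : ℕ} {θ : Node b → Node b}
    (hθ : IsThreading (x :: l) n θ) (h l₀ : ℕ) {u : Node b} (hu : u ∈ l) :
    θ u <+: nextThreading x h l₀ θ u := by
  unfold nextThreading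
  split_ifs with hxu
  · rw [← hθ.eq_of_prefix x List.mem_cons_self u (List.mem_cons_of_mem _ hu) hxu,
      List.append_assoc]
    exact List.prefix_append _ _
  · exact List.prefix_append _ _

end Node

namespace Node

variable {b : ℕ}

theorem IsThreading.of_eqOn {l : List (Node b)} {n : ℕ} {θ θ' : Node b → Node b}
    (hθ : IsThreading l n θ) (h : ∀ u ∈ l, θ' u = θ u) : IsThreading l n θ' where
  length_eq x hx := by rw [h x hx, hθ.length_eq x hx]
  eq_of_prefix x hx u hu := by rw [h x hx, h u hu]; exact hθ.eq_of_prefix x hx u hu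
  exists_prefix x hx u hu := by rw [h x hx, h u hu]; exact hθ.exists_prefix x hx u hu

variable [NeZero b]

/-- A partial word supported on the nodes `y ++ 0 ⋯ 0` with `y` of length `n` and fewer than `h`
zeros. -/
def spine {R : Type} (n h : ℕ) (g : Fin h → {s : Node b // s.length = n} → Option R)
    (z : Node b) : Option R :=
  if hz : (z.length - n < h ∧ (z.take n).length = n) ∧
      z = z.take n ++ List.replicate (z.length - n) 0 then
    g ⟨z.length - n, hz.1.1⟩ ⟨z.take n, hz.1.2⟩
  else none

theorem spine_apply {R : Type} {n h : ℕ} (g : Fin h → {s : Node b // s.length = n} → Option R)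
    (l : Fin h) (y : {s : Node b // s.length = n}) :
    spine n h g (y.1 ++ List.replicate l 0) = g l y := by
  obtain ⟨y, hy⟩ := y
  have h1 : (y ++ List.replicate (l : ℕ) (0 : Fin b)).take n = y := by
    rw [← hy, List.take_left]
  have h2 : (y ++ List.replicate (l : ℕ) (0 : Fin b)).length - n = l := by simp [hy]
  unfold spine
  rw [dif_pos ⟨⟨by rw [h2]; exact l.2, by rw [h1, hy]⟩, by rw [h2, h1]⟩]
  congr 1
  · exact Fin.ext h2
  · exact Subtype.ext h1

theorem spine_eq_some {R : Type} {n h : ℕ} {g : Fin h → {s : Node b // s.length = n} → Option R}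
    {z : Node b} {r : R} (hz : spine n h g z = some r) :
    ∃ (l : Fin h) (y : {s : Node b // s.length = n}),
      z = y.1 ++ List.replicate l 0 ∧ g l y = some r := by
  unfold spine at hz
  split_ifs at hz with h1
  exact ⟨_, _, h1.2, hz⟩

theorem spine_bind {R T : Type} {n h : ℕ} (g : Fin h → {s : Node b // s.length = n} → Option R)
    (F : R → Option T) (z : Node b) :
    (spine n h g z).bind F = spine n h (fun l y => (g l y).bind F) z := by
  unfold spine
  split_ifs <;> rfl

/-- The word that is `w` on the nodes of length less than `n` and `g` on the others. -/
def splice {R : Type} (n : ℕ) (w g : Node b → Option R) (z : Node b) : Option R :=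
  if z.length < n then w z else g z

/-- The label in `w` of a node, if this is an initial segment of `y`. -/
def letterValue {κ : Type} {n : ℕ} (w : Node b → Option κ) (y : Node b)
    (a : Option {s : Node b // s.length < n}) : Option κ :=
  a.bind fun i => if i.1 <+: y then w i.1 else none

/-- The classes on the block of levels between `n` and `n + h` that are given by a combinatorial
line. -/
def lineLabel (n h : ℕ) (s : Fin h → Option ({s : Node b // s.length = n} →
    Option {s : Node b // s.length < n})) (x : Node b) (θ : Node b → Node b) :
    Node b → Option (Node b ⊕ Node b) :=
  spine n h fun l y => (s l).elim (if y.1 = θ x then some (Sum.inr x) else none) fun μ =>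
    (μ y).bind fun i => if i.1 <+: y.1 then some (Sum.inl i.1) else none

/-- Hales–Jewett on the `h` levels above `n` places the first node `x`; the induction hypothesis
places the others from level `n + h` on. All threadings are treated at once because the position of
`x` changes the threads of the nodes above it. For `invariant`, labels of the tail are deleted first
and that of `x` last, by comparing two points of the line. -/
theorem exists_placement (κ C : Type) [Finite κ] [Finite C] (l : List (Node b))
    (hpw : l.Pairwise fun u w => ¬ w <+: u)
    (hconv : ∀ x ∈ l, ∀ u ∈ l, ∀ a, x ++ [a] <+: u → x ++ [a] ∈ l) (n : ℕ) :
    ∃ S, n ≤ S ∧ ∀ c : (Node b → Option κ) → C, ∃ U f, Placement c l n S U f := by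
  classical
  induction l generalizing n with
  | nil =>
    refine ⟨n, le_rfl, fun c => ⟨fun _ _ => none, fun _ => id, ?_⟩⟩
    constructor <;> try simp
    intro θ _ w v D _
    congr 1
  | cons x l ih =>
    rw [List.pairwise_cons] at hpw
    have hm : ∀ u ∈ l, u ∈ x :: l := fun u hu => List.mem_cons_of_mem _ hu
    have hxm : x ∈ x :: l := List.mem_cons_self
    have hxl : ∀ u ∈ l, u ≠ x := fun u hu e => hpw.1 u hu (e ▸ List.prefix_rfl)
    have hconvx : ∀ u ∈ l, ∀ a, x ++ [a] <+: u → x ++ [a] ∈ l := fun u hu a ha =>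
      (List.mem_cons.1 (hconv x hxm u (hm u hu) a ha)).resolve_left (by simp)
    have hconvl : ∀ x' ∈ l, ∀ u ∈ l, ∀ a, x' ++ [a] <+: u → x' ++ [a] ∈ l :=
      fun x' hx' u hu a ha => (List.mem_cons.1 (hconv x' (hm _ hx') u (hm u hu) a ha)).resolve_left
        fun e => hpw.1 x' hx' ⟨[a], e⟩
    have ih := ih hpw.2 hconvl
    let Y := {s : Node b // s.length = n}
    let P := {s : Node b // s.length < n}
    -- A letter tells each node of length `n` which shorter node it copies. The colour of a point is
    -- a function of the old word, the threading and the labels of the tail, so the line does not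
    -- depend on these.
    obtain ⟨h, hh⟩ := exists_monochromatic_line (Y → Option P)
      ((P → Option κ) × ({u // u ∈ x :: l} → Y) × ({u // u ∈ l} → Option κ) → C)
    obtain ⟨S, hS, ihS⟩ := ih (n + h)
    refine ⟨S, by omega, fun c => ?_⟩
    obtain ⟨U', f', H⟩ := ihS c
    -- The colour has to be fixed before the line, hence before `l₀` is known; the offset `0` stands
    -- in for it.
    obtain ⟨s, l₀, hl₀, hmin, hs⟩ := hh fun μ p =>
      c (extendWord (n + h)
        (U' (nextThreading x h 0 fun u => if hu : u ∈ x :: l then (p.2.1 ⟨u, hu⟩).1 else []))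
        (splice n (fun z => if hz : z.length < n then p.1 ⟨z, hz⟩ else none)
          (spine n h fun l y => letterValue
            (fun z => if hz : z.length < n then p.1 ⟨z, hz⟩ else none) y.1 (μ l y)))
        (fun u => if hu : u ∈ l then p.2.2 ⟨u, hu⟩ else none))
    have hh0 : 0 < h := by have := l₀.2; omega
    have hnext : ∀ θ, IsThreading (x :: l) n θ → ∀ k < h,
        IsThreading l (n + h) (nextThreading x h k θ) := fun θ hθ k hk =>
      hθ.next hpw.1 hconvx hk
    have hline : ∀ θ, IsThreading (x :: l) n θ → ∀ (w v : Node b → Option κ) (μ₁ μ₂ : Y → Option P),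
        c (extendWord (n + h) (U' (nextThreading x h 0 θ))
          (splice n w (spine n h fun l y => letterValue w y.1 ((s l).getD μ₁ y))) v) =
        c (extendWord (n + h) (U' (nextThreading x h 0 θ))
          (splice n w (spine n h fun l y => letterValue w y.1 ((s l).getD μ₂ y))) v) := by
      intro θ hθ w v μ₁ μ₂
      have key := congrFun (hs μ₁ μ₂) (fun i => w i.1,
        fun u => ⟨θ u.1, hθ.length_eq _ u.2⟩, fun u => v u.1)
      have hθ' : ∀ u ∈ x :: l, (fun u => if hu : u ∈ x :: l then θ u else []) u = θ u :=
        fun u hu => by simp only [hu, dif_pos]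
      have e : ∀ μ : Y → Option P, extendWord (n + h)
          (U' (nextThreading x h 0 fun u => if hu : u ∈ x :: l then θ u else []))
          (splice n (fun z => if hz : z.length < n then w z else none)
            (spine n h fun l y => letterValue
              (fun z => if hz : z.length < n then w z else none) y.1 ((s l).getD μ y)))
          (fun u => if hu : u ∈ l then v u else none) =
          extendWord (n + h) (U' (nextThreading x h 0 θ))
            (splice n w (spine n h fun l y => letterValue w y.1 ((s l).getD μ y))) v := by
        intro μ
        have e1 : (splice n (fun z => if hz : z.length < n then w z else none)
            (spine n h fun l y => letterValue
              (fun z => if hz : z.length < n then w z else none) y.1 ((s l).getD μ y))) =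
            splice n w (spine n h fun l y => letterValue w y.1 ((s l).getD μ y)) := by
          funext z
          unfold splice
          split_ifs with hz
          · simp [hz]
          · congr 1
            funext l y
            unfold letterValue
            congr 1
            funext i
            simp [i.2]
        rw [e1, H.congr _ _ (hnext _ (hθ.of_eqOn hθ') 0 hh0) (hnext θ hθ 0 hh0)]
        · refine extendWord_congr fun z u hu => ?_
          simp [(H.inr_spec _ (hnext θ hθ 0 hh0) z u hu).1]
        · intro u hu _
          unfold nextThreading
          simp only [hm u hu, hxm, dif_pos]
      rw [e, e] at key
      exact key
    let B := lineLabel n h s x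
    -- A later copy of a node in the block is resolved through the label of that node in the block,
    -- so it refers to a node shorter than `n` or to `x`.
    let U : (Node b → Node b) → Node b → Option (Node b ⊕ Node b) := fun θ z =>
      if z.length < n then none else if z.length < n + h then B θ z else
        (U' (nextThreading x h l₀ θ) z).bind (Sum.elim
          (fun i => if i.length < n then some (Sum.inl i) else B θ i) (fun u => some (Sum.inr u)))
    let f : (Node b → Node b) → Node b → Node b := fun θ u =>
      if u = x then θ x ++ List.replicate l₀ 0 else f' (nextThreading x h l₀ θ) u
    have hBl : ∀ θ z i, B θ z = some (Sum.inl i) → i.length < n ∧ i <+: z := by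
      intro θ z i hz
      obtain ⟨k, y, rfl, hk⟩ := spine_eq_some hz
      cases hsk : s k with
      | none =>
        rw [hsk, Option.elim_none] at hk
        split_ifs at hk
        simp at hk
      | some μ =>
        rw [hsk, Option.elim_some] at hk
        obtain ⟨j, -, hj⟩ := Option.bind_eq_some_iff.1 hk
        split_ifs at hj with hjy
        simp only [Option.some.injEq, Sum.inl.injEq] at hj
        exact ⟨hj ▸ j.2, hj ▸ hjy.trans (List.prefix_append _ _)⟩
    have hBr : ∀ θ z u, B θ z = some (Sum.inr u) →
        u = x ∧ θ x ++ List.replicate l₀ 0 <+: z := by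
      intro θ z u hz
      obtain ⟨k, y, rfl, hk⟩ := spine_eq_some hz
      cases hsk : s k with
      | none =>
        rw [hsk, Option.elim_none] at hk
        split_ifs at hk with hy
        simp only [Option.some.injEq, Sum.inr.injEq] at hk
        refine ⟨hk.symm, ?_⟩
        rw [hy, List.prefix_append_right_inj]
        exact (List.prefix_replicate_iff).2 ⟨by simpa using hmin k hsk, by simp⟩
      | some μ =>
        rw [hsk, Option.elim_some] at hk
        obtain ⟨j, -, hj⟩ := Option.bind_eq_some_iff.1 hk
        split_ifs at hj
        simp at hj
    have hext : ∀ θ (w v : Node b → Option κ), extendWord n (U θ) w v =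
        extendWord (n + h) (U' (nextThreading x h l₀ θ))
          (splice n w fun z => (B θ z).bind (Sum.elim w v)) v := by
      intro θ w v
      funext z
      simp only [extendWord, splice, U]
      split_ifs with h1 h2 h3
      · rfl
      · omega
      · rfl
      · rw [Option.bind_assoc]
        congr 1
        funext t
        cases t with
        | inl i => simp only [Sum.elim_inl]; split_ifs with h4 <;> simp [splice, h4]
        | inr u => rfl
    have hB : ∀ θ (w v : Node b → Option κ) (μ : Y → Option P),
        (∀ y : Y, letterValue w y.1 (μ y) = if y.1 = θ x then v x else none) →
        (fun z => (B θ z).bind (Sum.elim w v)) =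
          spine n h fun l y => letterValue w y.1 ((s l).getD μ y) := by
      intro θ w v μ hμ
      funext z
      simp only [B, lineLabel, spine_bind]
      congr 1
      funext k y
      cases s k with
      | none =>
        rw [Option.elim_none, Option.getD_none, hμ]
        split_ifs <;> rfl
      | some μ' =>
        rw [Option.elim_some, Option.getD_some, letterValue, Option.bind_assoc]
        congr 1
        funext i
        split_ifs <;> rfl
    refine ⟨U, f, ?_⟩
    have hfx : ∀ θ, f θ x = θ x ++ List.replicate l₀ 0 := fun θ => if_pos rfl
    have hfl : ∀ θ, ∀ u ∈ l, f θ u = f' (nextThreading x h l₀ θ) u := fun θ u hu => if_neg (hxl u hu)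
    have hN : ∀ θ, IsThreading (x :: l) n θ → IsThreading l (n + h) (nextThreading x h l₀ θ) :=
      fun θ hθ => hnext θ hθ l₀ l₀.2
    have hlen : ∀ θ, IsThreading (x :: l) n θ → ∀ u ∈ l, n + h ≤ (f θ u).length := by
      intro θ hθ u hu
      rw [hfl θ u hu, ← (hN θ hθ).length_eq u hu]
      exact (H.min_spec _ (hN θ hθ) u hu).2.length_le
    have hlx : ∀ θ, IsThreading (x :: l) n θ → (f θ x).length = n + l₀ := by
      intro θ hθ
      simp [hfx, hθ.length_eq x hxm]
    have hUlow : ∀ θ z, z.length < n → U θ z = none := fun θ z hz => if_pos hz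
    have hUmid : ∀ θ z, n ≤ z.length → z.length < n + h → U θ z = B θ z := fun θ z h1 h2 => by
      simp only [U, if_neg (not_lt.2 h1), if_pos h2]
    have hUhigh : ∀ θ z, n + h ≤ z.length → U θ z = (U' (nextThreading x h l₀ θ) z).bind (Sum.elim
        (fun i => if i.length < n then some (Sum.inl i) else B θ i) (fun u => some (Sum.inr u))) :=
      fun θ z h1 => by
        simp only [U, if_neg (not_lt.2 h1), if_neg (not_lt.2 ((Nat.le_add_right n h).trans h1))]
    have hBx : ∀ θ, IsThreading (x :: l) n θ → B θ (f θ x) = some (Sum.inr x) := by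
      intro θ hθ
      rw [hfx]
      have := spine_apply (h := h) (fun l y => (s l).elim
        (if y.1 = θ x then some (Sum.inr x) else none) fun μ =>
          (μ y).bind fun i => if i.1 <+: y.1 then some (Sum.inl i.1) else none) l₀
        ⟨θ x, hθ.length_eq x hxm⟩
      simp only [hl₀, Option.elim_none, if_true] at this
      exact this
    constructor
    · intro θ hθ z i hz
      rcases lt_or_ge z.length n with h1 | h1
      · simp [hUlow θ z h1] at hz
      rcases lt_or_ge z.length (n + h) with h2 | h2
      · rw [hUmid θ z h1 h2] at hz
        exact hBl θ z i hz
      · rw [hUhigh θ z h2] at hz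
        obtain ⟨t, ht, hti⟩ := Option.bind_eq_some_iff.1 hz
        cases t with
        | inr u => simp at hti
        | inl j =>
          have hj := H.inl_spec _ (hN θ hθ) z j ht
          rw [Sum.elim_inl] at hti
          split_ifs at hti with h3
          · simp only [Option.some.injEq, Sum.inl.injEq] at hti
            exact hti ▸ ⟨h3, hj.2⟩
          · have := hBl θ j i hti
            exact ⟨this.1, this.2.trans hj.2⟩
    · intro θ hθ z u hz
      rcases lt_or_ge z.length n with h1 | h1
      · simp [hUlow θ z h1] at hz
      rcases lt_or_ge z.length (n + h) with h2 | h2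
      · rw [hUmid θ z h1 h2] at hz
        obtain ⟨rfl, hu⟩ := hBr θ z u hz
        exact ⟨hxm, by rwa [hfx]⟩
      · rw [hUhigh θ z h2] at hz
        obtain ⟨t, ht, htu⟩ := Option.bind_eq_some_iff.1 hz
        cases t with
        | inr u' =>
          simp only [Sum.elim_inr, Option.some.injEq, Sum.inr.injEq] at htu
          subst htu
          have := H.inr_spec _ (hN θ hθ) z u' ht
          exact ⟨hm _ this.1, by rw [hfl θ _ this.1]; exact this.2⟩
        | inl j =>
          have hj := H.inl_spec _ (hN θ hθ) z j ht
          rw [Sum.elim_inl] at htu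
          split_ifs at htu with h3
          · simp at htu
          · obtain ⟨rfl, hu⟩ := hBr θ j u htu
            exact ⟨hxm, by rw [hfx]; exact hu.trans hj.2⟩
    · intro θ hθ u hu
      rcases List.mem_cons.1 hu with rfl | hu
      · refine ⟨?_, by rw [hfx]; exact List.prefix_append _ _⟩
        rw [hUmid, hBx θ hθ]
        · rw [hlx θ hθ]; omega
        · rw [hlx θ hθ]; omega
      · have := H.min_spec _ (hN θ hθ) u hu
        refine ⟨?_, ?_⟩
        · rw [hUhigh θ _ (hlen θ hθ u hu), hfl θ u hu, this.1]
          rfl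
        · rw [hfl θ u hu]
          exact (hθ.prefix_next h l₀ hu).trans this.2
    · intro θ hθ u hu a hua
      rcases List.mem_cons.1 hua with e | hul
      · rcases List.mem_cons.1 hu with rfl | hu
        · simp at e
        · exact absurd ⟨[a], e⟩ (hpw.1 u hu)
      rw [hfl θ _ hul]
      rcases List.mem_cons.1 hu with rfl | hu
      · rw [hfx]
        refine List.IsPrefix.trans ?_ (H.min_spec _ (hN θ hθ) _ hul).2
        unfold nextThreading
        rw [if_pos (List.prefix_append _ _), getD_of_append_prefix List.prefix_rfl,
          List.prefix_append_right_inj]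
        exact ⟨_, rfl⟩
      · rw [hfl θ u hu]
        exact H.child_spec _ (hN θ hθ) u hu a hul
    · intro θ hθ
      refine List.pairwise_cons.2 ⟨fun u hu => ?_, ?_⟩
      · rw [hlx θ hθ]
        have := hlen θ hθ u hu
        omega
      · refine (H.pairwise _ (hN θ hθ)).imp_of_mem fun hu hw huw => ?_
        rwa [hfl θ _ hu, hfl θ _ hw]
    · intro θ hθ z hz
      rcases lt_or_ge z.length (n + h) with h2 | h2
      · omega
      · refine H.length_lt _ (hN θ hθ) z fun e => hz ?_
        rw [hUhigh θ z h2, e]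
        rfl
    · intro θ θ' hθ hθ' w v hv
      rw [hext, hext]
      have e : (fun z => (B θ z).bind (Sum.elim w v)) =
          fun z => (B θ' z).bind (Sum.elim w v) := by
        funext z
        simp only [B, lineLabel, spine_bind]
        congr 1
        funext k y
        cases s k with
        | some μ => rfl
        | none =>
          simp only [Option.elim_none]
          by_cases hvx : v x = none
          · split_ifs <;> simp [hvx]
          · rw [hv x hxm hvx]
      rw [e]
      refine H.congr _ _ (hN θ hθ) (hN θ' hθ') _ _ fun u hu hvu => ?_
      unfold nextThreading
      split_ifs with hxu
      · rw [hθ.eq_of_prefix x hxm u (hm u hu) hxu, hθ'.eq_of_prefix x hxm u (hm u hu) hxu,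
          hv u (hm u hu) hvu]
      · rw [hv u (hm u hu) hvu]
    · intro θ hθ w v D hD hDv
      rw [hext, hext]
      have hBval : ∀ i, i.length < n → (splice n w fun z => (B θ z).bind (Sum.elim w v)) i = w i :=
        fun i hi => if_pos hi
      have hstep : c (extendWord (n + h) (U' (nextThreading x h l₀ θ))
          (splice n w fun z => (B θ z).bind (Sum.elim w v)) v) =
          c (extendWord (n + h) (U' (nextThreading x h l₀ θ))
          (splice n w fun z => (B θ z).bind (Sum.elim w v)) (deleteOn D v)) := by
        refine H.invariant _ (hN θ hθ) _ _ D hD fun u huD hu => ?_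
        rcases hDv u huD (hm u hu) with h0 | ⟨i, hi, hiu, hvi⟩ | ⟨i, hi, hiu, hiD, hvi⟩
        · exact Or.inl h0
        · exact Or.inr (Or.inl ⟨i, by omega, hiu.trans (hθ.prefix_next h l₀ hu),
            by rw [hBval i hi, hvi]⟩)
        -- A label repeating that of `x` is, for the tail, a label of the old word: it is found at
        -- `f θ x`, in the block and below the new thread.
        · rcases List.mem_cons.1 hi with rfl | hi
          · refine Or.inr (Or.inl ⟨f θ i, by rw [hlx θ hθ]; omega, ?_, ?_⟩)
            · rw [hfx]
              unfold nextThreading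
              rw [if_pos hiu, List.append_assoc]
              exact (List.prefix_append_right_inj _).2 (List.prefix_append _ _)
            · rw [splice, if_neg (by rw [hlx θ hθ]; omega), hBx θ hθ]
              exact hvi
          · exact Or.inr (Or.inr ⟨i, hi, hiu, hiD, hvi⟩)
      rw [hstep]
      by_cases hxD : x ∈ D
      · obtain ⟨μ₁, hμ₁⟩ : ∃ μ : Y → Option P, ∀ y : Y,
            letterValue w y.1 (μ y) = if y.1 = θ x then v x else none := by
          rcases hDv x hxD hxm with h0 | ⟨i, hi, hiu, hvi⟩ | ⟨i, hi, hiu, hiD, hvi⟩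
          · exact ⟨fun _ => none, fun y => by simp [letterValue, h0]⟩
          · refine ⟨fun y => if y.1 = θ x then some ⟨i, hi⟩ else none, fun y => ?_⟩
            split_ifs with hy
            · simp [letterValue, hy, hiu, hvi]
            · simp [letterValue, hy]
          · rcases List.mem_cons.1 hi with rfl | hi
            · exact absurd hxD hiD
            · exact absurd hiu (hpw.1 i hi)
        have hμ₂ : ∀ y : Y, letterValue w y.1 ((fun _ => none : Y → Option P) y) =
            if y.1 = θ x then deleteOn D v x else none := fun y => by
          simp [letterValue, deleteOn, hxD]
        rw [hB θ w v μ₁ hμ₁, hB θ w (deleteOn D v) _ hμ₂]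
        -- Since `x ∈ D`, all nodes above `x` are unlabelled by now. Only their threads depend on
        -- the offset, so `l₀` may be replaced by `0`.
        have hcg : ∀ u ∈ l, deleteOn D v u ≠ none →
            nextThreading x h l₀ θ u = nextThreading x h 0 θ u := by
          intro u hu hne
          unfold nextThreading
          have : ¬ x <+: u := fun hxu => hne (by simp [deleteOn, hD x hxD u hxu])
          rw [if_neg this, if_neg this]
        rw [H.congr _ _ (hN θ hθ) (hnext θ hθ 0 hh0) _ _ hcg,
          H.congr _ _ (hN θ hθ) (hnext θ hθ 0 hh0) _ _ hcg]
        exact hline θ hθ w _ μ₁ _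
      · congr 3
        funext z
        cases hz : B θ z with
        | none => rfl
        | some t =>
          cases t with
          | inl i => rfl
          | inr u =>
            obtain ⟨rfl, -⟩ := hBr θ z u hz
            simp [deleteOn, hxD]

-- All nodes of length less than `N` are placed in order of length, over an empty old tree and with
-- the constant threading. There is no old node to copy, so only repetitions of labels of
-- predecessors outside `D` remain in the condition.
open Classical in
theorem exists_offThread_invariant (κ C : Type) [Finite κ] [Finite C] (N : ℕ) :
    ∃ n : ℕ, ∀ c : (Node b → Option κ) → C, ∃ (U : Node b → Option (Node b))
      (f : Node b → Node b),
      (∀ z x, U z = some x → x.length < N ∧ f x <+: z ∧ z.length < n) ∧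
      (∀ x, x.length < N → U (f x) = some x) ∧
      (∀ x a, (x ++ [a]).length < N → f x ++ [a] <+: f (x ++ [a])) ∧
      (∀ x y, x.length < y.length → y.length < N → (f x).length < (f y).length) ∧
      ∀ (v : Node b → Option κ) (D : Set (Node b)), (∀ u ∈ D, ∀ u', u <+: u' → u' ∈ D) →
        (∀ u ∈ D, u.length < N → v u = none ∨ ∃ i, i <+: u ∧ i ∉ D ∧ v u = v i) →
        c (fun z => (U z).bind v) = c (fun z => (U z).bind (deleteOn D v)) := by
  let r : Node b → Node b → Prop := fun u w => u.length ≤ w.length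
  obtain ⟨l, hl, hsort, hnd⟩ : ∃ l : List (Node b), (∀ x, x ∈ l ↔ x.length < N) ∧
      l.Pairwise r ∧ l.Nodup := by
    have hfin : {s : Node b | s.length < N}.Finite := List.finite_length_lt (Fin b) N
    refine ⟨hfin.toFinset.toList.insertionSort r, fun x => ?_, ?_, ?_⟩
    · simp
    · have : Std.Total r := ⟨fun u w => le_total _ _⟩
      have : IsTrans (Node b) r := ⟨fun u w y => le_trans⟩
      exact List.pairwise_insertionSort r _
    · exact (List.perm_insertionSort r _).nodup_iff.2 (Finset.nodup_toList _)
  obtain ⟨S, -, hS⟩ := exists_placement κ C l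
    ((hsort.and hnd).imp fun {u w} huw hwu => huw.2 (hwu.eq_of_length_le huw.1).symm)
    (fun x hx u hu a h => (hl _).2 (lt_of_le_of_lt h.length_le ((hl _).1 hu))) 0
  refine ⟨S, fun c => ?_⟩
  obtain ⟨U, f, H⟩ := hS c
  have hθ : IsThreading l 0 (fun _ => []) := by
    refine ⟨fun _ _ => rfl, fun _ _ _ _ _ => rfl, fun x hx u hu _ => ⟨[], ?_, ?_, ?_⟩⟩
    · exact (hl _).2 (by have := (hl _).1 hx; simp; omega)
    · exact List.nil_prefix
    · exact List.nil_prefix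
  set θ : Node b → Node b := fun _ => [] with hθdef
  have hcomp : ∀ v : Node b → Option κ,
      (fun z => ((U θ z).bind (Sum.elim (fun _ => none) some)).bind v) =
        extendWord 0 (U θ) (fun _ => none) v := by
    intro v
    funext z
    simp only [extendWord, not_lt_zero, if_false, Option.bind_assoc]
    congr 1
    funext t
    cases t <;> rfl
  have hU : ∀ z x, (U θ z).bind (Sum.elim (fun _ => none) some) = some x →
      U θ z = some (Sum.inr x) := by
    intro z x hz
    obtain ⟨t, ht, htx⟩ := Option.bind_eq_some_iff.1 hz
    cases t with
    | inl i => simp at htx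
    | inr u =>
      simp only [Sum.elim_inr, Option.some.injEq] at htx
      rw [ht, htx]
  refine ⟨fun z => (U θ z).bind (Sum.elim (fun _ => none) some), f θ, fun z x hz => ?_,
    fun x hx => ?_, fun x a hx => ?_, fun x y hxy hy => ?_, fun v D hD hv => ?_⟩
  · have h1 := hU z x hz
    obtain ⟨h2, h3⟩ := H.inr_spec θ hθ z x h1
    exact ⟨(hl x).1 h2, h3, H.length_lt θ hθ z (by simp [h1])⟩
  · simp [(H.min_spec θ hθ x ((hl x).2 hx)).1]
  · refine H.child_spec θ hθ x ((hl x).2 ?_) a ((hl _).2 hx)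
    simp at hx
    omega
  · have hx' : x ∈ l := (hl x).2 (by omega)
    have hy' : y ∈ l := (hl y).2 hy
    have key : l.Pairwise fun u w => u.length ≤ w.length ∧ (f θ u).length < (f θ w).length :=
      hsort.and (H.pairwise θ hθ)
    by_contra hcon
    -- Placing order agrees with length, so any two distinct nodes are comparable in both lengths
    -- simultaneously.
    have : ∀ u ∈ l, ∀ w ∈ l, u = w ∨ (u.length ≤ w.length ∧ (f θ u).length < (f θ w).length) ∨
        (w.length ≤ u.length ∧ (f θ w).length < (f θ u).length) := by
      intro u hu w hw
      by_cases huw : u = w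
      · exact Or.inl huw
      · right
        refine List.Pairwise.forall_of_forall_of_flip (R := fun u w => u = w ∨ (u.length ≤ w.length ∧ (f θ u).length < (f θ w).length) ∨
        (w.length ≤ u.length ∧ (f θ w).length < (f θ u).length)) ?_ ?_ ?_ hu hw |>.resolve_left huw
        · exact fun _ _ => Or.inl rfl
        · exact key.imp fun h => Or.inr (Or.inl h)
        · exact key.imp fun h => Or.inr (Or.inr h)
    rcases this x hx' y hy' with rfl | h1 | h1
    · omega
    · exact hcon h1.2
    · omega
  · show c (fun z => ((U θ z).bind (Sum.elim (fun _ => none) some)).bind v) =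
      c (fun z => ((U θ z).bind (Sum.elim (fun _ => none) some)).bind (deleteOn D v))
    rw [hcomp, hcomp]
    refine H.invariant θ hθ _ _ D hD fun u huD hu => ?_
    have huN := (hl u).1 hu
    rcases hv u huD huN with h0 | ⟨i, hi, hiD, hvi⟩
    · exact Or.inl h0
    · exact Or.inr (Or.inr ⟨i, (hl i).2 (lt_of_le_of_lt hi.length_le huN), hi, hiD, hvi⟩)

end Node

/-! ### Prefix, breadth-first and lexicographic orders. -/

namespace Node

variable {b : ℕ}

/-- Two sequences are comparable or split at some place. -/
theorem prefix_or_prefix_or_split (s t : Node b) : s <+: t ∨ t <+: s ∨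
    ∃ (p : Node b) (i j : Fin b), i ≠ j ∧ p ++ [i] <+: s ∧ p ++ [j] <+: t := by
  induction s generalizing t with
  | nil => exact Or.inl List.nil_prefix
  | cons i s ih =>
    cases t with
    | nil => exact Or.inr (Or.inl List.nil_prefix)
    | cons j t =>
      by_cases hij : i = j
      · subst hij
        rcases ih t with h | h | ⟨p, i', j', hne, h1, h2⟩
        · exact Or.inl ((List.cons_prefix_cons).2 ⟨rfl, h⟩)
        · exact Or.inr (Or.inl ((List.cons_prefix_cons).2 ⟨rfl, h⟩))
        · exact Or.inr (Or.inr ⟨i :: p, i', j', hne, (List.cons_prefix_cons).2 ⟨rfl, h1⟩,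
            (List.cons_prefix_cons).2 ⟨rfl, h2⟩⟩)
      · exact Or.inr (Or.inr ⟨[], i, j, hij, by simp, by simp⟩)

theorem eq_of_append_prefix {p s : Node b} {i j : Fin b} (hi : p ++ [i] <+: s)
    (hj : p ++ [j] <+: s) : i = j := by
  obtain ⟨t, rfl⟩ := hi
  rw [List.append_assoc, List.prefix_append_right_inj] at hj
  have := List.cons_prefix_cons.1 (by simpa using hj : j :: [] <+: i :: t)
  exact this.1.symm

theorem prefix_of_split {p q s t : Node b} {i j : Fin b} (hij : i ≠ j) (hi : p ++ [i] <+: s)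
    (hj : p ++ [j] <+: t) (hs : q <+: s) (ht : q <+: t) : q <+: p := by
  rcases prefix_or_prefix_or_split q p with h | h | ⟨r, i', j', hne, h1, h2⟩
  · exact h
  · by_cases hpq : p = q
    · rw [hpq]
    · obtain ⟨a, ha⟩ := exists_append_prefix h hpq
      exact absurd ((eq_of_append_prefix hi (ha.trans hs)).trans
        (eq_of_append_prefix hj (ha.trans ht)).symm) hij
  · exact absurd (eq_of_append_prefix (h1.trans hs)
      (h2.trans ((List.prefix_append _ _).trans hi))) hne

theorem not_prefix_append {s : Node b} {i : Fin b} : ¬ s ++ [i] <+: s := fun h => by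
  simpa using h.length_le

/-- The rank of a sequence in the enumeration of all sequences by length and, for equal lengths,
lexicographically. -/
def rank (s : Node b) : ℕ := s.foldl (fun p a => b * p + 1 + a) 0

theorem rank_append (s : Node b) (a : Fin b) : rank (s ++ [a]) = b * rank s + 1 + a := by
  simp [rank]

/-- The children of a node of rank `p` have the ranks from `b * p + 1` to `b * p + b`; these blocks
are disjoint and increase with `p`. -/
theorem rank_append_lt {s t : Node b} (h : rank s < rank t) (i j : Fin b) :
    rank (s ++ [i]) < rank (t ++ [j]) := by
  rw [rank_append, rank_append]
  have := i.2
  have := Nat.mul_le_mul_left b (Nat.succ_le_of_lt h)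
  rw [Nat.mul_succ] at this
  omega

theorem rank_lt_of_length_lt {s t : Node b} (h : s.length < t.length) : rank s < rank t := by
  induction t using List.reverseRecOn generalizing s with
  | nil => simp at h
  | append_singleton t j ih =>
    cases s using List.reverseRecOn with
    | nil => rw [rank_append]; simp [rank]
    | append_singleton s i =>
      exact rank_append_lt (ih (by simpa using h)) i j

theorem rank_lt_of_split {p u v : Node b} {i j : Fin b} (hij : i < j) (h : u.length = v.length) :
    rank (p ++ i :: u) < rank (p ++ j :: v) := by
  induction u using List.reverseRecOn generalizing v with
  | nil =>
    have : v = [] := List.length_eq_zero_iff.1 h.symm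
    subst this
    rw [rank_append, rank_append]
    have : (i : ℕ) < j := hij
    omega
  | append_singleton u i' ih =>
    cases v using List.reverseRecOn with
    | nil => simp at h
    | append_singleton v j' =>
      have := rank_append_lt (ih (v := v) (by simpa using h)) i' j'
      simpa using this

theorem rank_injective : Injective (rank : Node b → ℕ) := by
  intro s t h
  have hlen : s.length = t.length := by
    rcases lt_trichotomy s.length t.length with h1 | h1 | h1
    · have := rank_lt_of_length_lt h1; omega
    · exact h1
    · have := rank_lt_of_length_lt h1; omega
  have key : ∀ (s t p : Node b) (i j : Fin b), s.length = t.length → p ++ [i] <+: s →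
      p ++ [j] <+: t → i < j → rank s < rank t := by
    rintro _ _ p i j hl ⟨u, rfl⟩ ⟨v, rfl⟩ hij
    have := rank_lt_of_split (p := p) (u := u) (v := v) hij (by simpa using hl)
    simpa using this
  rcases prefix_or_prefix_or_split s t with h1 | h1 | ⟨p, i, j, hne, h1, h2⟩
  · exact h1.eq_of_length hlen
  · exact (h1.eq_of_length hlen.symm).symm
  · rcases lt_or_gt_of_ne hne with hij | hij
    · have := key s t p i j hlen h1 h2 hij; omega
    · have := key t s p j i hlen.symm h2 h1 hij; omega

theorem rank_le_of_prefix {s t : Node b} (h : s <+: t) : rank s ≤ rank t := by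
  rcases h.length_le.lt_or_eq with h1 | h1
  · exact (rank_lt_of_length_lt h1).le
  · rw [h.eq_of_length h1]

theorem le_of_prefix {s t : Node b} (h : s <+: t) : s ≤ t := by
  obtain ⟨u, rfl⟩ := h
  cases u with
  | nil => rw [List.append_nil]
  | cons a u =>
    refine le_of_lt ?_
    induction s with
    | nil => exact List.Lex.nil
    | cons i s ih => exact List.Lex.cons ih

theorem lt_of_split {p s t : Node b} {i j : Fin b} (hij : i < j) (hi : p ++ [i] <+: s)
    (hj : p ++ [j] <+: t) : s < t := by
  obtain ⟨u, rfl⟩ := hi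
  obtain ⟨v, rfl⟩ := hj
  induction p with
  | nil => exact List.Lex.rel hij
  | cons a p ih => exact List.Lex.cons ih

/-- The cone above `y` is convex in the lexicographic order, so a node outside it lies on the same
side of all its members. -/
theorem lt_of_lt_of_prefix {u w y z : Node b} (huw : u < w) (hw : y <+: w) (hz : y <+: z)
    (hu : ¬ y <+: u) : u < z := by
  rcases prefix_or_prefix_or_split u y with h | h | ⟨p, i, j, hne, h1, h2⟩
  · refine lt_of_le_of_ne (le_of_prefix (h.trans hz)) fun e => ?_
    subst e
    exact hu hz
  · exact absurd h hu
  · rcases lt_or_gt_of_ne hne with hij | hij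
    · exact lt_of_split hij h1 (h2.trans hz)
    · exact absurd (lt_of_split hij (h2.trans hw) h1) (not_lt.2 huw.le)

end Node

/-! ### Skew embeddings. -/

namespace TreeNode

variable {b n k m : ℕ}

instance : Finite (TreeNode b n) :=
  Finite.of_injective (fun s => (⟨s.seq, s.length_lt⟩ : {s : Node b // s.length < n}))
    fun _ _ h => TreeNode.ext (congrArg Subtype.val h)

/-- The position in the enumeration of the tree by levels. -/
def rank (s : TreeNode b n) : ℕ := Node.rank s.seq

theorem rank_injective : Injective (rank : TreeNode b n → ℕ) :=
  fun _ _ h => TreeNode.ext (Node.rank_injective h)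

theorem seq_injective : Injective (seq : TreeNode b n → List (Fin b)) := fun _ _ h => TreeNode.ext h

theorem rank_mono {s t : TreeNode b n} (h : s ≤ t) : s.rank ≤ t.rank := Node.rank_le_of_prefix h

theorem rank_strictMono {s t : TreeNode b n} (h : s < t) : s.rank < t.rank :=
  (rank_mono h.le).lt_of_ne fun e => h.ne (rank_injective e)

/-- Restriction of a node to an initial segment. -/
def ofPrefix (s : TreeNode b n) (p : Node b) (h : p <+: s.seq) : TreeNode b n :=
  ⟨p, h.length_le.trans_lt s.length_lt⟩

theorem exists_child_of_lt {s t : TreeNode b n} (h : s < t) : ∃ a, s.seq ++ [a] <+: t.seq :=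
  Node.exists_append_prefix h.le fun e => h.ne (TreeNode.ext e)

theorem lt_of_child {s t : TreeNode b n} {a : Fin b} (h : s.seq ++ [a] <+: t.seq) : s < t :=
  lt_of_le_of_ne ((List.prefix_append _ _).trans h) fun e => by
    subst e
    exact Node.not_prefix_append h

theorem le_total_of_le {s t u : TreeNode b n} (hs : s ≤ u) (ht : t ≤ u) : s ≤ t ∨ t ≤ s :=
  List.prefix_or_prefix_of_prefix hs ht

theorem le_of_rank_le {s t u : TreeNode b n} (hs : s ≤ u) (ht : t ≤ u) (h : s.rank ≤ t.rank) :
    s ≤ t := by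
  rcases le_total_of_le hs ht with h1 | h1
  · exact h1
  · rw [rank_injective (h.antisymm (rank_mono h1))]

theorem le_or_le_or_split (s t : TreeNode b n) : s ≤ t ∨ t ≤ s ∨
    ∃ (p : TreeNode b n) (i j : Fin b), i ≠ j ∧ p.seq ++ [i] <+: s.seq ∧ p.seq ++ [j] <+: t.seq := by
  rcases Node.prefix_or_prefix_or_split s.seq t.seq with h | h | ⟨p, i, j, hne, h1, h2⟩
  · exact Or.inl h
  · exact Or.inr (Or.inl h)
  · exact Or.inr (Or.inr ⟨s.ofPrefix p ((List.prefix_append _ _).trans h1), i, j, hne, h1, h2⟩)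

/-- An embedding of `b^{<k}` into the infinite tree that respects directions and the enumeration by
levels. Its image is a complete skew subtree. -/
structure IsSkewEmbedding (f : TreeNode b k → Node b) : Prop where
  child : ∀ x y a, x.seq ++ [a] <+: y.seq → f x ++ [a] <+: f y
  rank_lt : ∀ x y, x.rank < y.rank → Node.rank (f x) < Node.rank (f y)

namespace IsSkewEmbedding

variable {f : TreeNode b k → Node b} (hf : IsSkewEmbedding f)
include hf

theorem injective : Injective f := fun x y h => by
  rcases lt_trichotomy x.rank y.rank with h1 | h1 | h1
  · exact absurd (hf.rank_lt x y h1) (by rw [h]; exact lt_irrefl _)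
  · exact rank_injective h1
  · exact absurd (hf.rank_lt y x h1) (by rw [h]; exact lt_irrefl _)

theorem prefix_of_le {x y : TreeNode b k} (h : x ≤ y) : f x <+: f y := by
  rcases h.lt_or_eq with h1 | rfl
  · obtain ⟨a, ha⟩ := exists_child_of_lt h1
    exact (List.prefix_append _ _).trans (hf.child x y a ha)
  · exact List.prefix_rfl

theorem le_of_prefix {x y : TreeNode b k} (h : f x <+: f y) : x ≤ y := by
  rcases le_or_le_or_split x y with h1 | h1 | ⟨p, i, j, hne, h1, h2⟩
  · exact h1
  · rw [hf.injective (h.eq_of_length_le (hf.prefix_of_le h1).length_le)]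
  · exact absurd (Node.eq_of_append_prefix ((hf.child p x i h1).trans h) (hf.child p y j h2)) hne

theorem child_of_prefix {x y : TreeNode b k} {a : Fin b} (h : f x ++ [a] <+: f y) :
    x.seq ++ [a] <+: y.seq := by
  have hle := hf.le_of_prefix ((List.prefix_append _ _).trans h)
  have hne : x ≠ y := fun e => by
    subst e
    exact Node.not_prefix_append h
  obtain ⟨a', ha'⟩ := exists_child_of_lt (lt_of_le_of_ne hle hne)
  rwa [Node.eq_of_append_prefix h (hf.child x y a' ha')]

theorem rank_le_iff {x y : TreeNode b k} : Node.rank (f x) ≤ Node.rank (f y) ↔ x.rank ≤ y.rank := by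
  refine ⟨fun h => not_lt.1 fun h1 => not_lt.2 h (hf.rank_lt y x h1), fun h => ?_⟩
  rcases h.lt_or_eq with h1 | h1
  · exact (hf.rank_lt x y h1).le
  · rw [rank_injective h1]

theorem lex_lt {x y : TreeNode b k} (h : x.seq < y.seq) : f x < f y := by
  rcases le_or_le_or_split x y with h1 | h1 | ⟨p, i, j, hne, h1, h2⟩
  · refine lt_of_le_of_ne (Node.le_of_prefix (hf.prefix_of_le h1)) fun e => ?_
    rw [hf.injective e] at h
    exact lt_irrefl _ h
  · exact absurd h (not_lt.2 (Node.le_of_prefix h1))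
  · rcases lt_or_gt_of_ne hne with hij | hij
    · exact Node.lt_of_split hij (hf.child p x i h1) (hf.child p y j h2)
    · exact absurd (Node.lt_of_split hij h2 h1) (not_lt.2 h.le)

/-- If `x` and `y` split at `p`, their images split exactly above `f p`, because directions are
preserved; a common prefix of the images is then a prefix of `f p`. -/
theorem exists_le_of_prefix {x y : TreeNode b k} {q : Node b} (hx : q <+: f x) (hy : q <+: f y) :
    ∃ w, w ≤ x ∧ w ≤ y ∧ q <+: f w := by
  rcases le_or_le_or_split x y with h1 | h1 | ⟨p, i, j, hne, h1, h2⟩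
  · exact ⟨x, le_rfl, h1, hx⟩
  · exact ⟨y, h1, le_rfl, hy⟩
  · exact ⟨p, (lt_of_child h1).le, (lt_of_child h2).le,
      Node.prefix_of_split hne (hf.child p x i h1) (hf.child p y j h2) hx hy⟩

end IsSkewEmbedding

end TreeNode

/-! ### Words of levels and the labelled trees they describe. -/

namespace TreeNode

variable {b k m : ℕ}

/-- The types of levels in the universal tree: a level `node q`, in which the node `q` is placed,
is preceded by levels `buffer q z p a`, in which the thread of `z` goes in direction `a` and carries
the label `p`. -/
inductive Level (b k : ℕ)
  | node (q : TreeNode b k) : Level b k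
  | buffer (q z : TreeNode b k) (p : Option (TreeNode b k)) (a : Fin b) : Level b k

namespace Level

/-- The node that is placed next. -/
def stage : Level b k → TreeNode b k
  | node q => q
  | buffer q _ _ _ => q

/-- The rank of a label, where the absence of a label comes first. -/
def labelRank (p : Option (TreeNode b k)) : WithBot ℕ := p.elim ⊥ fun p => (p.rank : WithBot ℕ)

theorem labelRank_injective : Injective (labelRank : Option (TreeNode b k) → WithBot ℕ) := by
  intro p p' h
  cases p <;> cases p' <;> simp [labelRank] at h
  · rfl
  · rw [rank_injective h]

/-- The key by which levels are ordered. -/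
def key : Level b k → ℕ ×ₗ WithTop (Node b ×ₗ (WithBot ℕ ×ₗ Fin b))
  | node q => toLex (q.rank, ⊤)
  | buffer q z p a => toLex (q.rank, ((toLex (z.seq, toLex (labelRank p, a)) :
      Node b ×ₗ (WithBot ℕ ×ₗ Fin b)) : WithTop (Node b ×ₗ (WithBot ℕ ×ₗ Fin b))))

theorem key_injective : Injective (key : Level b k → _) := by
  intro μ μ' h
  cases μ with
  | node q =>
    cases μ' with
    | node q' =>
      simp only [key, toLex_inj, Prod.mk.injEq, and_true] at h
      rw [rank_injective h]
    | buffer q' z' p' a' => simp [key] at h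
  | buffer q z p a =>
    cases μ' with
    | node q' => simp [key] at h
    | buffer q' z' p' a' =>
      simp only [key, toLex_inj, Prod.mk.injEq, WithTop.coe_inj] at h
      obtain ⟨h1, h2, h3, rfl⟩ := h
      rw [rank_injective h1, seq_injective h2, labelRank_injective h3]

/-- The stage comes first. Within a stage the buffers are sorted by thread, label and direction, and
the node comes last. `IsReduction.rigidWord_levelMap` depends on this choice. -/
noncomputable instance : LinearOrder (Level b k) := LinearOrder.lift' key key_injective

instance : Finite (Level b k) :=
  Finite.of_injective (β := TreeNode b k × Option (TreeNode b k × Option (TreeNode b k) × Fin b))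
    (fun μ => match μ with
      | node q => (q, none)
      | buffer q z p a => (q, some (z, p, a))) fun μ μ' h => by
      cases μ <;> cases μ' <;> simp_all

noncomputable instance : Fintype (Level b k) := Fintype.ofFinite _

theorem lt_iff_key {μ μ' : Level b k} : μ < μ' ↔ key μ < key μ' := Iff.rfl

theorem lt_of_stage {μ μ' : Level b k} (h : μ.stage.rank < μ'.stage.rank) : μ < μ' := by
  rw [lt_iff_key]
  cases μ <;> cases μ' <;> exact Prod.Lex.toLex_lt_toLex.2 (Or.inl h)

theorem stage_le {μ μ' : Level b k} (h : μ ≤ μ') : μ.stage.rank ≤ μ'.stage.rank :=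
  not_lt.1 fun h1 => not_lt.2 h (lt_of_stage h1)

theorem node_lt_node {q q' : TreeNode b k} : node q < node q' ↔ q.rank < q'.rank := by
  rw [lt_iff_key]
  simp [key, Prod.Lex.toLex_lt_toLex]

theorem buffer_lt_node {q z q' : TreeNode b k} {p : Option (TreeNode b k)} {a : Fin b} :
    buffer q z p a < node q' ↔ q.rank ≤ q'.rank := by
  rw [lt_iff_key]
  simp [key, Prod.Lex.toLex_lt_toLex, le_iff_lt_or_eq, WithTop.coe_lt_top]

theorem node_lt_buffer {q z q' : TreeNode b k} {p : Option (TreeNode b k)} {a : Fin b} :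
    node q < buffer q' z p a ↔ q.rank < q'.rank := by
  rw [lt_iff_key]
  simp [key, Prod.Lex.toLex_lt_toLex]

theorem buffer_lt_buffer {q z z' : TreeNode b k} {p p' : Option (TreeNode b k)} {a a' : Fin b} :
    buffer q z p a < buffer q z' p' a' ↔ z.seq < z'.seq ∨ z = z' ∧
      (labelRank p < labelRank p' ∨ p = p' ∧ a < a') := by
  rw [lt_iff_key]
  simp [key, Prod.Lex.toLex_lt_toLex, WithTop.coe_lt_coe, labelRank_injective.eq_iff,
    seq_injective.eq_iff]

end Level

/-- Just before `q` is placed, `x` and `z` belong to the same open cone. -/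
def SameFront (q x z : TreeNode b k) : Prop := ∃ y, q.rank ≤ y.rank ∧ y ≤ x ∧ y ≤ z

theorem SameFront.symm {q x z : TreeNode b k} (h : SameFront q x z) : SameFront q z x := by
  obtain ⟨y, h1, h2, h3⟩ := h
  exact ⟨y, h1, h3, h2⟩

theorem SameFront.trans {q x y z : TreeNode b k} (h : SameFront q x y) (h' : SameFront q y z) :
    SameFront q x z := by
  obtain ⟨u, h1, h2, h3⟩ := h
  obtain ⟨w, h4, h5, h6⟩ := h'
  rcases le_total_of_le h3 h5 with huw | huw
  · exact ⟨u, h1, h2, huw.trans h6⟩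
  · exact ⟨w, h4, huw.trans h2, h6⟩

theorem sameFront_iff_of_le {q x y z : TreeNode b k} (hxy : x ≤ y) (hq : q.rank ≤ x.rank) :
    SameFront q z x ↔ SameFront q z y := by
  have h : SameFront q x y := ⟨x, hq, le_rfl, hxy⟩
  exact ⟨fun h' => h'.trans h, fun h' => h'.trans h.symm⟩

theorem SameFront.le_iff {q x y p : TreeNode b k} (h : SameFront q x y) (hp : p.rank ≤ q.rank) :
    p ≤ x ↔ p ≤ y := by
  obtain ⟨u, h1, h2, h3⟩ := h
  exact ⟨fun h => (le_of_rank_le h h2 (hp.trans h1)).trans h3,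
    fun h => (le_of_rank_le h h3 (hp.trans h1)).trans h2⟩

/-- The first level of a given type. -/
noncomputable def firstLevel (w : ℕ → Option (Level b k)) (μ : Level b k) : ℕ :=
  sInf {l | w l = some μ}

theorem firstLevel_spec {w : ℕ → Option (Level b k)} (hw : RigidWord w) (μ : Level b k) :
    w (firstLevel w μ) = some μ :=
  Nat.sInf_mem (s := {l | w l = some μ}) (hw.surj μ)

theorem firstLevel_le {w : ℕ → Option (Level b k)} {μ : Level b k} {l : ℕ} (h : w l = some μ) :
    firstLevel w μ ≤ l :=
  Nat.sInf_le h

theorem firstLevel_strictMono {w : ℕ → Option (Level b k)} (hw : RigidWord w) :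
    StrictMono (firstLevel w) := by
  intro μ μ' h
  obtain ⟨l, hl, hμ⟩ := hw.initial _ _ _ (firstLevel_spec hw μ') h
  exact (firstLevel_le hμ).trans_lt hl

variable [NeZero b]

/-- The direction after `q` of a node above `q`. -/
def dirAfter (q x : TreeNode b k) : Fin b := x.seq.getD q.seq.length 0

theorem dirAfter_eq {q x : TreeNode b k} {a : Fin b} (h : q.seq ++ [a] <+: x.seq) :
    dirAfter q x = a := Node.getD_of_append_prefix h

theorem dirAfter_spec {q x : TreeNode b k} (h : q < x) : q.seq ++ [dirAfter q x] <+: x.seq := by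
  obtain ⟨a, ha⟩ := exists_child_of_lt h
  rwa [dirAfter_eq ha]

open Classical in
/-- The direction of the thread of `x` in a level. -/
noncomputable def dig (x : TreeNode b k) : Level b k → Fin b
  | .node q => if q < x then dirAfter q x else 0
  | .buffer q z _ a => if SameFront q z x then a else 0

open Classical in
/-- The label of the thread of `x` in a level. -/
noncomputable def lab (x : TreeNode b k) : Level b k → Option (TreeNode b k)
  | .node q => if q ≤ x then some q else none
  | .buffer q z p _ => if SameFront q z x then
      p.bind fun p => if p.rank < q.rank ∧ p ≤ x then some p else none
    else none

section
open Classical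

theorem dig_node_of_lt {q x : TreeNode b k} (h : q < x) : dig x (.node q) = dirAfter q x :=
  if_pos h

theorem dig_node_of_not_lt {q x : TreeNode b k} (h : ¬ q < x) : dig x (.node q) = 0 :=
  if_neg h

theorem dig_buffer_congr {q z z' : TreeNode b k} {q'' z'' x' : TreeNode b m}
    {p : Option (TreeNode b k)} {p' : Option (TreeNode b m)} {a : Fin b}
    (h : SameFront q z z' ↔ SameFront q'' z'' x') :
    dig z' (.buffer q z p a) = dig x' (.buffer q'' z'' p' a) :=
  if_congr h rfl rfl

/-- Before `x` is placed, a node above `x` is in the same front as `x`, so no level can separate the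
two. -/
theorem dig_eq_of_le {x y : TreeNode b k} (hxy : x ≤ y) {μ : Level b k} (hμ : μ < .node x) :
    dig x μ = dig y μ := by
  cases μ with
  | node q =>
    have hq := Level.node_lt_node.1 hμ
    by_cases h : q < x
    · rw [dig_node_of_lt h, dig_node_of_lt (h.trans_le hxy),
        dirAfter_eq ((dirAfter_spec h).trans hxy)]
    · have h' : ¬ q < y := fun h' => h (lt_of_le_of_ne (le_of_rank_le h'.le hxy hq.le)
        fun e => by rw [e] at hq; exact lt_irrefl _ hq)
      rw [dig_node_of_not_lt h, dig_node_of_not_lt h']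
  | buffer q z p a =>
    exact dig_buffer_congr (sameFront_iff_of_le hxy (Level.buffer_lt_node.1 hμ))

omit [NeZero b] in
theorem SameFront.lab_eq {x y : TreeNode b k} {μ : Level b k} (h : SameFront μ.stage x y) :
    lab x μ = lab y μ := by
  cases μ with
  | node q => exact if_congr (h.le_iff (p := q) le_rfl) rfl rfl
  | buffer q z p a =>
    refine if_congr ⟨fun h' => h'.trans h, fun h' => h'.trans h.symm⟩ ?_ rfl
    cases p with
    | none => rfl
    | some p => exact if_congr (and_congr_right fun hp => h.le_iff (le_of_lt hp)) rfl rfl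

end

/-- The direction of the thread of `x` at a level. -/
noncomputable def digAt (w : ℕ → Option (Level b k)) (x : TreeNode b k) (l : ℕ) : Fin b :=
  (w l).elim 0 (dig x)

/-- The place of the node `x` in the universal tree with levels `w`. -/
noncomputable def thread (w : ℕ → Option (Level b k)) (x : TreeNode b k) : Node b :=
  (List.range (firstLevel w (.node x))).map (digAt w x)

open Classical in
/-- The labelling of the universal tree with levels `w`. -/
noncomputable def threadLabel (w : ℕ → Option (Level b k)) (z : Node b) : Option (TreeNode b k) :=
  if h : ∃ x, z <+: thread w x then (w z.length).bind (lab h.choose) else none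

theorem length_thread (w : ℕ → Option (Level b k)) (x : TreeNode b k) :
    (thread w x).length = firstLevel w (.node x) := by
  simp [thread]

theorem getElem_thread {w : ℕ → Option (Level b k)} {x : TreeNode b k} {z : Node b}
    (h : z <+: thread w x) {l : ℕ} (hl : l < z.length) : z[l] = digAt w x l := by
  rw [h.getElem hl]
  simp [thread]

section Rigid

variable {w : ℕ → Option (Level b k)} (hw : RigidWord w)
include hw

theorem digAt_eq_of_le {x y : TreeNode b k} (hxy : x ≤ y) {l : ℕ}
    (hl : l < firstLevel w (.node x)) : digAt w x l = digAt w y l := by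
  unfold digAt
  cases hμ : w l with
  | none => rfl
  | some μ =>
    exact dig_eq_of_le hxy ((firstLevel_strictMono hw).lt_iff_lt.1 ((firstLevel_le hμ).trans_lt hl))

theorem thread_child {x y : TreeNode b k} {a : Fin b} (h : x.seq ++ [a] <+: y.seq) :
    thread w x ++ [a] <+: thread w y := by
  have hxy := lt_of_child h
  have hlt : firstLevel w (.node x) < firstLevel w (.node y) :=
    firstLevel_strictMono hw (Level.node_lt_node.2 (rank_strictMono hxy))
  have h1 : thread w x ++ [a] = (List.range (firstLevel w (.node x) + 1)).map (digAt w y) := by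
    rw [List.range_succ, List.map_append, thread]
    congr 1
    · exact List.map_congr_left fun l hl => digAt_eq_of_le hw hxy.le (List.mem_range.1 hl)
    · simp only [List.map_cons, List.map_nil, digAt, firstLevel_spec hw, Option.elim_some, dig,
        if_pos hxy, dirAfter_eq h]
  rw [h1]
  unfold thread
  refine List.IsPrefix.map _ ?_
  obtain ⟨d, hd⟩ := Nat.exists_eq_add_of_lt hlt
  rw [show firstLevel w (.node y) = (firstLevel w (.node x) + 1) + d by omega,
    List.range_add (n := firstLevel w (.node x) + 1)]
  exact List.prefix_append _ _

theorem thread_isSkewEmbedding : IsSkewEmbedding (thread w) where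
  child _ _ _ h := thread_child hw h
  rank_lt x y h := Node.rank_lt_of_length_lt (by
    rw [length_thread, length_thread]
    exact firstLevel_strictMono hw (Level.node_lt_node.2 h))

theorem thread_length_lt {x y : TreeNode b k} (h : x.rank < y.rank) :
    (thread w x).length < (thread w y).length := by
  rw [length_thread, length_thread]
  exact firstLevel_strictMono hw (Level.node_lt_node.2 h)

/-- This makes `threadLabel` independent of the chosen thread. If `x` and `y` split at a node `p`
placed before the stage of the level, their threads differ at the place of `p`, below `z`. Otherwise
they are in one front, and labels are constant on fronts. -/
theorem lab_eq_of_prefix_thread {x y : TreeNode b k} {z : Node b} (hx : z <+: thread w x)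
    (hy : z <+: thread w y) : (w z.length).bind (lab x) = (w z.length).bind (lab y) := by
  cases hμ : w z.length with
  | none => rfl
  | some μ =>
    have hle : ∀ {x}, z <+: thread w x → μ.stage.rank ≤ x.rank := fun {x} hx =>
      Level.stage_le (μ' := .node x) ((firstLevel_strictMono hw).le_iff_le.1
        ((firstLevel_le hμ).trans (by rw [← length_thread]; exact hx.length_le)))
    refine SameFront.lab_eq ?_
    rcases le_or_le_or_split x y with h | h | ⟨p, i, j, hne, h1, h2⟩
    · exact ⟨x, hle hx, le_rfl, h⟩
    · exact ⟨y, hle hy, h, le_rfl⟩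
    · refine ⟨p, not_lt.1 fun hp => hne ?_, (lt_of_child h1).le, (lt_of_child h2).le⟩
      have hl : firstLevel w (.node p) < z.length :=
        (firstLevel_strictMono hw (Level.lt_of_stage (μ := .node p) hp)).trans_le
          (firstLevel_le hμ)
      have e1 := getElem_thread hx hl
      have e2 := getElem_thread hy hl
      rw [e1] at e2
      simpa only [digAt, firstLevel_spec hw, Option.elim_some, dig, if_pos (lt_of_child h1),
        if_pos (lt_of_child h2), dirAfter_eq h1, dirAfter_eq h2] using e2

theorem threadLabel_eq {x : TreeNode b k} {z : Node b} (h : z <+: thread w x) :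
    threadLabel w z = (w z.length).bind (lab x) := by
  have hz : ∃ x, z <+: thread w x := ⟨x, h⟩
  rw [threadLabel, dif_pos hz]
  exact lab_eq_of_prefix_thread hw hz.choose_spec h

theorem threadLabel_thread (x : TreeNode b k) : threadLabel w (thread w x) = some x := by
  rw [threadLabel_eq hw List.prefix_rfl, length_thread, firstLevel_spec hw]
  simp [lab]

/-- By definition of `lab`, a buffer shows the label `p` only on threads of nodes above `p`, and
only at stages after `p` has been placed. -/
theorem thread_prefix_of_threadLabel {x : TreeNode b k} {z : Node b}
    (h : threadLabel w z = some x) : thread w x <+: z := by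
  by_cases hz : ∃ y, z <+: thread w y
  · obtain ⟨y, hy⟩ := hz
    rw [threadLabel_eq hw hy] at h
    obtain ⟨μ, hμ, hx⟩ := Option.bind_eq_some_iff.1 h
    have key : x ≤ y ∧ firstLevel w (.node x) ≤ z.length := by
      cases μ with
      | node q =>
        simp only [lab] at hx
        split_ifs at hx with hq
        obtain rfl := Option.some.inj hx
        exact ⟨hq, firstLevel_le hμ⟩
      | buffer q z' p a =>
        simp only [lab] at hx
        split_ifs at hx
        obtain ⟨p', -, hp⟩ := Option.bind_eq_some_iff.1 hx
        split_ifs at hp with hp'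
        obtain rfl := Option.some.inj hp
        exact ⟨hp'.2, (firstLevel_strictMono hw (Level.node_lt_buffer.2 hp'.1)).le.trans
          (firstLevel_le hμ)⟩
    refine List.prefix_of_prefix_length_le ((thread_isSkewEmbedding hw).prefix_of_le key.1) hy ?_
    rw [length_thread]
    exact key.2
  · rw [threadLabel, dif_neg hz] at h
    simp at h

end Rigid

end TreeNode

/-! ### Reductions and the level words they induce. -/

namespace TreeNode

variable {b k m : ℕ}

/-- A labelling `v` of `b^{<m}` by `b^{<k}` whose classes have minima `g x`, where `g` is a skew
embedding. -/
structure IsReduction (v : TreeNode b m → Option (TreeNode b k))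
    (g : TreeNode b k → TreeNode b m) : Prop where
  isSkewEmbedding : IsSkewEmbedding fun x => (g x).seq
  apply_eq : ∀ x, v (g x) = some x
  le_of_eq_some : ∀ z x, v z = some x → g x ≤ z

/-- `j` is the first node whose image is not placed before `q`. -/
def IsNext (g : TreeNode b k → TreeNode b m) (q : TreeNode b m) (j : TreeNode b k) : Prop :=
  ∀ i, q.rank ≤ (g i).rank ↔ j.rank ≤ i.rank

open Classical in
/-- The first node whose image is not placed before `q`. -/
noncomputable def next (g : TreeNode b k → TreeNode b m) (q : TreeNode b m) :
    Option (TreeNode b k) :=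
  if h : ∃ j, IsNext g q j then some h.choose else none

open Classical in
/-- The node whose thread represents the thread of `z` just before `q` is placed. -/
noncomputable def front (g : TreeNode b k → TreeNode b m) (q z : TreeNode b m) :
    Option (TreeNode b k) :=
  if h : ∃ i, g i = z then some h.choose
  else if h : ∃ i, SameFront q z (g i) ∧ ∀ i', SameFront q z (g i') → i.seq ≤ i'.seq then
    some h.choose
  else none

open Classical in
/-- The label of a buffer level after reduction. -/
noncomputable def reducedLabel (v : TreeNode b m → Option (TreeNode b k))
    (g : TreeNode b k → TreeNode b m) (q z : TreeNode b m) (p : Option (TreeNode b m)) :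
    Option (TreeNode b k) :=
  p.bind fun p => if (p.rank < q.rank ∧ p ≤ z) ∨ ∃ i, g i = p then v p else none

theorem IsNext.unique {g : TreeNode b k → TreeNode b m} {q : TreeNode b m} {j j' : TreeNode b k}
    (h : IsNext g q j) (h' : IsNext g q j') : j = j' :=
  rank_injective (le_antisymm ((h j').1 ((h' j').2 le_rfl)) ((h' j).1 ((h j).2 le_rfl)))

theorem next_eq_some {g : TreeNode b k → TreeNode b m} {q : TreeNode b m} {j : TreeNode b k} :
    next g q = some j ↔ IsNext g q j := by
  unfold next
  split_ifs with h
  · refine ⟨fun e => ?_, fun hj => congrArg some (h.choose_spec.unique hj)⟩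
    rw [← Option.some.inj e]
    exact h.choose_spec
  · exact ⟨False.elim, fun hj => absurd ⟨j, hj⟩ h⟩

theorem front_spec {g : TreeNode b k → TreeNode b m} {q z : TreeNode b m} {i : TreeNode b k}
    (h : front g q z = some i) :
    g i = z ∨ SameFront q z (g i) ∧ ∀ i', SameFront q z (g i') → i.seq ≤ i'.seq := by
  unfold front at h
  split_ifs at h with h1 h2
  · rw [← Option.some.inj h]
    exact Or.inl h1.choose_spec
  · rw [← Option.some.inj h]
    exact Or.inr h2.choose_spec

theorem exists_front {g : TreeNode b k → TreeNode b m} {q z : TreeNode b m} {i : TreeNode b k}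
    (h : SameFront q z (g i)) : ∃ j, front g q z = some j := by
  unfold front
  split_ifs with h1 h2
  · exact ⟨_, rfl⟩
  · exact ⟨_, rfl⟩
  · obtain ⟨j, hj, hmin⟩ := Set.exists_min_image {i | SameFront q z (g i)} seq (Set.toFinite _)
      ⟨i, h⟩
    exact absurd ⟨j, hj, hmin⟩ h2

section

variable [NeZero b]

open Classical in
/-- The map between the types of levels that is induced by a reduction. -/
noncomputable def levelMap (v : TreeNode b m → Option (TreeNode b k))
    (g : TreeNode b k → TreeNode b m) : Level b m → Option (Level b k)
  | .node q =>
    if h : ∃ i, g i = q then some (.node h.choose)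
    else if h : ∃ i, q < g i then
      (next g q).map fun j => .buffer j h.choose (v q) (dirAfter q (g h.choose))
    else none
  | .buffer q z p a => (next g q).bind fun j => (front g q z).map fun i =>
      .buffer j i (reducedLabel v g q z p) a

end

namespace IsReduction

variable {v : TreeNode b m → Option (TreeNode b k)} {g : TreeNode b k → TreeNode b m}
  (h : IsReduction v g)
include h

theorem injective : Injective g := fun x y e => by
  simpa [h.apply_eq] using congrArg v e

theorem le_iff {x y : TreeNode b k} : g x ≤ g y ↔ x ≤ y :=
  ⟨fun h' => h.isSkewEmbedding.le_of_prefix h', fun h' => h.isSkewEmbedding.prefix_of_le h'⟩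

theorem lt_iff {x y : TreeNode b k} : g x < g y ↔ x < y := by
  rw [lt_iff_le_and_ne, lt_iff_le_and_ne, h.le_iff, h.injective.ne_iff]

theorem rank_le_iff {x y : TreeNode b k} : (g x).rank ≤ (g y).rank ↔ x.rank ≤ y.rank :=
  h.isSkewEmbedding.rank_le_iff

theorem isNext_apply (j : TreeNode b k) : IsNext g (g j) j := fun _ => h.rank_le_iff

theorem exists_next {q : TreeNode b m} {i : TreeNode b k} (hi : q.rank ≤ (g i).rank) :
    ∃ j, IsNext g q j := by
  obtain ⟨j, hj, hmin⟩ := Set.exists_min_image {i | q.rank ≤ (g i).rank} rank (Set.toFinite _)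
    ⟨i, hi⟩
  exact ⟨j, fun i' => ⟨fun h' => hmin i' h', fun h' => le_trans hj (h.rank_le_iff.2 h')⟩⟩

theorem front_apply (q : TreeNode b m) (i : TreeNode b k) : front g q (g i) = some i := by
  have h1 : ∃ i', g i' = g i := ⟨i, rfl⟩
  rw [front, dif_pos h1]
  exact congrArg some (h.injective h1.choose_spec)

/-- The second alternative in `reducedLabel` serves this identity: every buffer, even one whose
label can never be shown, needs a preimage under `levelMap`. -/
theorem reducedLabel_map (q z : TreeNode b m) (p : Option (TreeNode b k)) :
    reducedLabel v g q z (p.map g) = p := by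
  cases p with
  | none => rfl
  | some p =>
    simp only [reducedLabel, Option.map_some, Option.bind_some]
    rw [if_pos (Or.inr ⟨p, rfl⟩), h.apply_eq]

theorem sameFront_iff {q : TreeNode b m} {j x y : TreeNode b k} (hj : IsNext g q j) :
    SameFront q (g x) (g y) ↔ SameFront j x y := by
  constructor
  · rintro ⟨u, h1, h2, h3⟩
    obtain ⟨w, hx, hy, hw⟩ := h.isSkewEmbedding.exists_le_of_prefix h2 h3
    exact ⟨w, (hj w).1 (h1.trans (rank_mono (t := g w) hw)), hx, hy⟩
  · rintro ⟨w, h1, h2, h3⟩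
    exact ⟨g w, (hj w).2 h1, h.le_iff.2 h2, h.le_iff.2 h3⟩

theorem sameFront_front_iff {q z : TreeNode b m} {j i x : TreeNode b k} (hj : IsNext g q j)
    (hi : front g q z = some i) : SameFront q z (g x) ↔ SameFront j i x := by
  rw [← h.sameFront_iff hj]
  rcases front_spec hi with rfl | ⟨h1, -⟩
  · rfl
  · exact ⟨fun h' => h1.symm.trans h', fun h' => h1.trans h'⟩

variable [NeZero b]

theorem levelMap_node_apply (i : TreeNode b k) : levelMap v g (.node (g i)) = some (.node i) := by
  have h1 : ∃ i', g i' = g i := ⟨i, rfl⟩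
  rw [levelMap, dif_pos h1]
  exact congrArg _ (congrArg _ (h.injective h1.choose_spec))

omit h in
theorem levelMap_buffer {q z : TreeNode b m} {j i : TreeNode b k} (hj : IsNext g q j)
    (hi : front g q z = some i) (p : Option (TreeNode b m)) (a : Fin b) :
    levelMap v g (.buffer q z p a) = some (.buffer j i (reducedLabel v g q z p) a) := by
  simp only [levelMap, next_eq_some.2 hj, hi, Option.bind_some, Option.map_some]

theorem levelMap_buffer_apply {q : TreeNode b m} {j : TreeNode b k} (hj : IsNext g q j)
    (i : TreeNode b k) (p : Option (TreeNode b k)) (a : Fin b) :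
    levelMap v g (.buffer q (g i) (p.map g) a) = some (.buffer j i p a) := by
  rw [levelMap_buffer hj (h.front_apply q i), h.reducedLabel_map]

theorem levelMap_node_of_lt {q : TreeNode b m} (hq : ¬ ∃ i, g i = q) (hi : ∃ i, q < g i) :
    ∃ i j, q < g i ∧ IsNext g q j ∧
      levelMap v g (.node q) = some (.buffer j i (v q) (dirAfter q (g i))) := by
  obtain ⟨j, hj⟩ := h.exists_next (rank_mono hi.choose_spec.le)
  refine ⟨hi.choose, j, hi.choose_spec, hj, ?_⟩
  rw [levelMap, dif_neg hq, dif_pos hi, next_eq_some.2 hj]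
  rfl

omit h in
theorem levelMap_node_of_not_lt {q : TreeNode b m} (hq : ¬ ∃ i, g i = q) (hi : ¬ ∃ i, q < g i) :
    levelMap v g (.node q) = none := by
  rw [levelMap, dif_neg hq, dif_neg hi]

omit h in
theorem exists_of_levelMap_buffer {q z : TreeNode b m} {p : Option (TreeNode b m)} {a : Fin b}
    {ν : Level b k} (hν : levelMap v g (.buffer q z p a) = some ν) :
    ∃ j i, IsNext g q j ∧ front g q z = some i ∧ ν = .buffer j i (reducedLabel v g q z p) a := by
  rw [levelMap] at hν
  obtain ⟨j, hj, hν⟩ := Option.bind_eq_some_iff.1 hν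
  obtain ⟨i, hi, hν⟩ := Option.map_eq_some_iff.1 hν
  exact ⟨j, i, next_eq_some.1 hj, hi, hν.symm⟩

/-- Hence the place of `i` after substitution is the old place of `g i`: no other level can
contribute an earlier `node i`. -/
theorem levelMap_eq_node {μ : Level b m} {i : TreeNode b k} :
    levelMap v g μ = some (.node i) ↔ μ = .node (g i) := by
  refine ⟨fun hμ => ?_, fun hμ => hμ ▸ h.levelMap_node_apply i⟩
  cases μ with
  | node q =>
    by_cases hq : ∃ i, g i = q
    · obtain ⟨i', rfl⟩ := hq
      rw [h.levelMap_node_apply] at hμ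
      cases hμ
      rfl
    · by_cases hi : ∃ i, q < g i
      · obtain ⟨i', j, -, -, e⟩ := h.levelMap_node_of_lt hq hi
        rw [e] at hμ
        cases hμ
      · rw [levelMap_node_of_not_lt hq hi] at hμ
        cases hμ
  | buffer q z p a =>
    obtain ⟨j, i', -, -, e⟩ := exists_of_levelMap_buffer hμ
    cases e

theorem isNext_stage {μ : Level b m} {ν : Level b k} (hν : levelMap v g μ = some ν) :
    IsNext g μ.stage ν.stage := by
  cases μ with
  | node q =>
    by_cases hq : ∃ i, g i = q
    · obtain ⟨i, rfl⟩ := hq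
      rw [h.levelMap_node_apply] at hν
      cases hν
      exact h.isNext_apply i
    · by_cases hi : ∃ i, q < g i
      · obtain ⟨i', j, -, hj, e⟩ := h.levelMap_node_of_lt hq hi
        rw [e] at hν
        cases hν
        exact hj
      · rw [levelMap_node_of_not_lt hq hi] at hν
        cases hν
  | buffer q z p a =>
    obtain ⟨j, i', hj, -, rfl⟩ := exists_of_levelMap_buffer hν
    exact hj

theorem exists_levelMap_eq (ν : Level b k) :
    ∃ μ, levelMap v g μ = some ν ∧ μ.stage = g ν.stage := by
  cases ν with
  | node q => exact ⟨_, h.levelMap_node_apply q, rfl⟩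
  | buffer q z p a => exact ⟨_, h.levelMap_buffer_apply (h.isNext_apply q) z p a, rfl⟩

-- If `p` is reduced to `x`, then `g x ≤ p` since `g x` is the minimum of its class, and `g`
-- preserves ranks.
omit [NeZero b] in
theorem labelRank_lt {q z : TreeNode b m} {p : Option (TreeNode b m)} {p' : Option (TreeNode b k)}
    (hp : Level.labelRank p' < Level.labelRank (reducedLabel v g q z p)) :
    Level.labelRank (p'.map g) < Level.labelRank p := by
  cases hx : reducedLabel v g q z p with
  | none => rw [hx] at hp; simp [Level.labelRank] at hp
  | some x =>
    rw [hx] at hp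
    obtain ⟨y, rfl, hy⟩ := Option.bind_eq_some_iff.1 hx
    cases p' with
    | none => simp [Level.labelRank]
    | some x' =>
      split_ifs at hy
      have h1 : x'.rank < x.rank := by simpa [Level.labelRank] using hp
      have h2 : (g x').rank < (g x).rank := not_le.1 fun h' => not_le.2 h1 (h.rank_le_iff.1 h')
      have h3 := rank_mono (h.le_of_eq_some _ _ hy)
      simpa [Level.labelRank] using h2.trans_le h3

/-- Given a preimage of `ν` and some `ν' < ν`, an earlier preimage of `ν'` is required. For a
smaller stage it is the lift of `ν'` along `g`. For the same stage `ν'` must be a buffer, and it is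
lifted to the stage of the given level; the comparisons of threads, labels and directions then carry
over separately. -/
theorem rigidWord_levelMap : RigidWord (levelMap v g) where
  surj ν := (h.exists_levelMap_eq ν).imp fun _ => And.left
  initial μ ν' ν hν hlt := by
    have hj := h.isNext_stage hν
    rcases (Level.stage_le hlt.le).lt_or_eq with hs | hs
    · obtain ⟨μ', h1, h2⟩ := h.exists_levelMap_eq ν'
      refine ⟨μ', Level.lt_of_stage ?_, h1⟩
      rw [h2]
      exact not_le.1 fun h' => not_le.2 hs ((hj _).1 h')
    · have hs := rank_injective hs
      cases ν' with
      | node j =>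
        cases ν with
        | node j' =>
          obtain rfl : j = j' := hs
          exact (lt_irrefl _ hlt).elim
        | buffer j' z p a =>
          obtain rfl : j = j' := hs
          exact (lt_irrefl _ (Level.node_lt_buffer.1 hlt)).elim
      | buffer j i' p' a' =>
        have hj' : IsNext g μ.stage j := by rw [show j = ν.stage from hs]; exact hj
        cases μ with
        | node q =>
          exact ⟨_, Level.buffer_lt_node.2 le_rfl, h.levelMap_buffer_apply hj' i' p' a'⟩
        | buffer q z p a =>
          obtain ⟨j₁, i, hj₁, hi, rfl⟩ := exists_of_levelMap_buffer hν
          obtain rfl := hj'.unique hj₁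
          rcases Level.buffer_lt_buffer.1 hlt with h1 | ⟨rfl, h1 | ⟨rfl, h1⟩⟩
          · refine ⟨_, Level.buffer_lt_buffer.2 (Or.inl ?_), h.levelMap_buffer_apply hj' i' p' a'⟩
            have h2 : (g i').seq < (g i).seq := h.isSkewEmbedding.lex_lt h1
            rcases front_spec hi with rfl | ⟨⟨y, hy1, hy2, hy3⟩, hmin⟩
            · exact h2
            -- `front` takes the lexicographically least representative, so `g i'` cannot lie in the
            -- cone of `z`; by convexity it precedes `z` as it precedes `g i`.
            · refine Node.lt_of_lt_of_prefix h2 hy3 hy2 fun hy4 => ?_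
              exact not_le.2 h1 (hmin i' ⟨y, hy1, hy2, hy4⟩)
          · refine ⟨.buffer q z (p'.map g) a', Level.buffer_lt_buffer.2 (Or.inr ⟨rfl, Or.inl
              (h.labelRank_lt h1)⟩), ?_⟩
            rw [levelMap_buffer hj₁ hi, h.reducedLabel_map]
          · exact ⟨_, Level.buffer_lt_buffer.2 (Or.inr ⟨rfl, Or.inr ⟨rfl, h1⟩⟩),
              levelMap_buffer hj₁ hi p a'⟩

-- The buffer that replaces an unselected node `q` thus moves exactly the selected threads passing
-- through `q`.
omit [NeZero b] in
theorem sameFront_iff_lt {q : TreeNode b m} {i j x : TreeNode b k} (hq : ¬ ∃ i, g i = q)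
    (hi : q < g i) (hj : IsNext g q j) : SameFront j i x ↔ q < g x := by
  constructor
  · rintro ⟨w, h1, h2, h3⟩
    exact lt_of_le_of_ne ((le_of_rank_le hi.le (h.le_iff.2 h2) ((hj w).2 h1)).trans
      (h.le_iff.2 h3)) fun e => hq ⟨x, e.symm⟩
  · intro hx
    rw [← h.sameFront_iff hj]
    exact ⟨q, le_rfl, hi.le, hx.le⟩

theorem dirAfter_apply {x y : TreeNode b k} (hxy : x < y) :
    dirAfter (g x) (g y) = dirAfter x y := by
  obtain ⟨a, ha⟩ := exists_child_of_lt hxy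
  rw [dirAfter_eq ha, dirAfter_eq (h.isSkewEmbedding.child x y a ha)]

/-- Two images above `q` have a common predecessor in the image of `g` that is still above `q`, so
they cannot split at an unselected node. One direction therefore suffices for the replacing buffer.
-/
theorem dirAfter_eq_of_lt {q : TreeNode b m} {x y : TreeNode b k} (hq : ¬ ∃ i, g i = q)
    (hx : q < g x) (hy : q < g y) : dirAfter q (g x) = dirAfter q (g y) := by
  obtain ⟨w, h1, h2, h3⟩ := h.isSkewEmbedding.exists_le_of_prefix hx.le hy.le
  have hw : q < g w := lt_of_le_of_ne h3 fun e => hq ⟨w, e.symm⟩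
  rw [dirAfter_eq ((dirAfter_spec hw).trans (h.le_iff.2 h1)),
    dirAfter_eq ((dirAfter_spec hw).trans (h.le_iff.2 h2))]

theorem dig_apply (i : TreeNode b k) {μ : Level b m} (hμ : μ.stage.rank ≤ (g i).rank) :
    dig (g i) μ = (levelMap v g μ).elim 0 (dig i) := by
  classical
  cases μ with
  | node q =>
    by_cases hq : ∃ i, g i = q
    · obtain ⟨x, rfl⟩ := hq
      rw [h.levelMap_node_apply, Option.elim_some]
      by_cases hx : x < i
      · rw [dig_node_of_lt hx, dig_node_of_lt (h.lt_iff.2 hx), h.dirAfter_apply hx]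
      · rw [dig_node_of_not_lt hx, dig_node_of_not_lt (mt h.lt_iff.1 hx)]
    · by_cases hi : ∃ i, q < g i
      · obtain ⟨x, j, hx, hj, e⟩ := h.levelMap_node_of_lt hq hi
        rw [e, Option.elim_some, dig, dig]
        by_cases hqi : q < g i
        · rw [if_pos hqi, if_pos ((h.sameFront_iff_lt hq hx hj).2 hqi)]
          exact h.dirAfter_eq_of_lt hq hqi hx
        · rw [if_neg hqi, if_neg (mt (h.sameFront_iff_lt hq hx hj).1 hqi)]
      · rw [levelMap_node_of_not_lt hq hi, dig_node_of_not_lt fun h' => hi ⟨i, h'⟩]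
        rfl
  | buffer q z p a =>
    obtain ⟨j, hj⟩ := h.exists_next (q := q) hμ
    by_cases hs : ∃ x, SameFront q z (g x)
    · obtain ⟨i₀, hi₀⟩ := exists_front hs.choose_spec
      rw [levelMap_buffer hj hi₀, Option.elim_some]
      exact dig_buffer_congr (h.sameFront_front_iff hj hi₀)
    · have h1 : ¬ SameFront q z (g i) := fun h' => hs ⟨i, h'⟩
      rw [dig, if_neg h1]
      cases hf : front g q z with
      | none => simp [levelMap, hf]
      | some i₀ =>
        rw [levelMap_buffer hj hf, Option.elim_some, dig,
          if_neg (mt (h.sameFront_front_iff hj hf).2 h1)]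

/-- If `v p = some y` then `g y ≤ p`, so `y` is placed and below the thread whenever `p` is: an
admissible label stays admissible. An inadmissible `p` either reduces to no label or is some `g x`,
and then `x` is inadmissible too. -/
theorem lab_apply (i : TreeNode b k) {μ : Level b m} (hμ : μ.stage.rank ≤ (g i).rank) :
    (lab (g i) μ).bind v = (levelMap v g μ).bind (lab i) := by
  classical
  cases μ with
  | node q =>
    by_cases hq : ∃ i, g i = q
    · obtain ⟨x, rfl⟩ := hq
      rw [h.levelMap_node_apply, Option.bind_some, lab, lab]
      by_cases hx : x ≤ i
      · rw [if_pos hx, if_pos (h.le_iff.2 hx), Option.bind_some, h.apply_eq]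
      · rw [if_neg hx, if_neg (mt h.le_iff.1 hx), Option.bind_none]
    · have hle : q ≤ g i ↔ q < g i := ⟨fun h' => lt_of_le_of_ne h' fun e => hq ⟨i, e.symm⟩, le_of_lt⟩
      by_cases hi : ∃ i, q < g i
      · obtain ⟨x, j, hx, hj, e⟩ := h.levelMap_node_of_lt hq hi
        rw [e, Option.bind_some, lab, lab]
        by_cases hqi : q < g i
        · rw [if_pos hqi.le, if_pos ((h.sameFront_iff_lt hq hx hj).2 hqi), Option.bind_some]
          cases hv : v q with
          | none => rfl
          | some y =>
            have hy := h.le_of_eq_some _ _ hv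
            have hy' : (g y).rank < q.rank :=
              rank_strictMono (lt_of_le_of_ne hy fun e => hq ⟨y, e⟩)
            rw [Option.bind_some, if_pos ⟨not_le.1 fun h' => not_le.2 hy' ((hj y).2 h'),
              h.le_iff.1 (hy.trans hqi.le)⟩]
        · rw [if_neg (mt hle.1 hqi), if_neg (mt (h.sameFront_iff_lt hq hx hj).1 hqi),
            Option.bind_none]
      · rw [levelMap_node_of_not_lt hq hi, lab, if_neg fun h' => hi ⟨i, hle.1 h'⟩]
        rfl
  | buffer q z p a =>
    obtain ⟨j, hj⟩ := h.exists_next (q := q) hμ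
    rw [lab]
    cases hf : front g q z with
    | none =>
      rw [if_neg fun h' => by obtain ⟨x, hx⟩ := exists_front h'; rw [hf] at hx; cases hx]
      simp [levelMap, hf]
    | some i₀ =>
      rw [levelMap_buffer hj hf, Option.bind_some, lab]
      by_cases hs : SameFront q z (g i)
      · rw [if_pos hs, if_pos ((h.sameFront_front_iff hj hf).1 hs)]
        cases p with
        | none => rfl
        | some p =>
          simp only [reducedLabel, Option.bind_some]
          by_cases hp : p.rank < q.rank ∧ p ≤ z
          · have hpi : p ≤ g i := (hs.le_iff hp.1.le).1 hp.2
            rw [if_pos ⟨hp.1, hpi⟩, if_pos (Or.inl hp), Option.bind_some]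
            cases hv : v p with
            | none => rfl
            | some y =>
              have hy := h.le_of_eq_some _ _ hv
              rw [Option.bind_some, if_pos ⟨not_le.1 fun h' =>
                not_le.2 ((rank_mono hy).trans_lt hp.1) ((hj y).2 h'), h.le_iff.1 (hy.trans hpi)⟩]
          · have hpi : ¬ (p.rank < q.rank ∧ p ≤ g i) := fun h' =>
              hp ⟨h'.1, (hs.le_iff h'.1.le).2 h'.2⟩
            rw [if_neg hpi, Option.bind_none]
            by_cases hx : ∃ x, g x = p
            · obtain ⟨x, rfl⟩ := hx
              rw [if_pos (Or.inr ⟨x, rfl⟩), h.apply_eq, Option.bind_some, if_neg fun h' => hpi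
                ⟨not_le.1 fun h'' => not_le.2 h'.1 ((hj x).1 h''), h.le_iff.2 h'.2⟩]
            · rw [if_neg (not_or.2 ⟨hp, hx⟩), Option.bind_none]
      · rw [if_neg hs, if_neg (mt (h.sameFront_front_iff hj hf).2 hs), Option.bind_none]

end IsReduction

end TreeNode

/-! ### Monochromatic labellings. -/

theorem RigidWord.bind {α β γ : Type*} [LT α] [LT β] [LT γ] {w : α → Option β} {v : β → Option γ}
    (hw : RigidWord w) (hv : RigidWord v) : RigidWord fun l => (w l).bind v where
  surj z := by
    obtain ⟨y, hy⟩ := hv.surj z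
    obtain ⟨l, hl⟩ := hw.surj y
    exact ⟨l, by simp [hl, hy]⟩
  initial l z' z hz hlt := by
    obtain ⟨y, hl, hy⟩ := Option.bind_eq_some_iff.1 hz
    obtain ⟨y', hy', hz'⟩ := hv.initial y z' z hy hlt
    obtain ⟨l', hl', hly'⟩ := hw.initial l y' y hl hy'
    exact ⟨l', hl', by simp [hly', hz']⟩

namespace TreeNode

variable {b k m : ℕ} [NeZero b]

omit [NeZero b] in
theorem stage_rank_le_of_firstLevel {w : ℕ → Option (Level b k)} (hw : RigidWord w) {l : ℕ}
    {μ : Level b k} (hμ : w l = some μ) {x : TreeNode b k} (hl : l ≤ firstLevel w (.node x)) :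
    μ.stage.rank ≤ x.rank :=
  Level.stage_le (μ' := .node x) ((firstLevel_strictMono hw).le_iff_le.1
    ((firstLevel_le hμ).trans hl))

section Reduction

variable {v : TreeNode b m → Option (TreeNode b k)} {g : TreeNode b k → TreeNode b m}
  (h : IsReduction v g) {W : ℕ → Option (Level b m)} (hW : RigidWord W)
include h

theorem IsReduction.firstLevel_eq (i : TreeNode b k) :
    firstLevel (fun l => (W l).bind (levelMap v g)) (.node i) = firstLevel W (.node (g i)) := by
  unfold firstLevel
  congr 1
  ext l
  simp [Option.bind_eq_some_iff, h.levelMap_eq_node]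

include hW

theorem IsReduction.thread_eq (i : TreeNode b k) :
    thread (fun l => (W l).bind (levelMap v g)) i = thread W (g i) := by
  rw [thread, thread, h.firstLevel_eq]
  refine List.map_congr_left fun l hl => ?_
  simp only [digAt]
  cases hμ : W l with
  | none => rfl
  | some μ => exact (h.dig_apply i (stage_rank_le_of_firstLevel hW hμ (List.mem_range.1 hl).le)).symm

/-- On the selected threads the labels agree level by level. Off them the substituted word gives no
labels, while `v` may still give some; off-thread invariance absorbs this difference. -/
theorem IsReduction.threadLabel_eq (u : Node b) :
    threadLabel (fun l => (W l).bind (levelMap v g)) u =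
      Node.deleteOn {u | ¬ ∃ i, u <+: thread W (g i)} (fun u => (threadLabel W u).bind v) u := by
  unfold Node.deleteOn
  by_cases hu : ∃ i, u <+: thread W (g i)
  · obtain ⟨i, hi⟩ := hu
    rw [if_neg fun h' : u ∈ {u | ¬ ∃ i, u <+: thread W (g i)} => h' ⟨i, hi⟩]
    simp only [TreeNode.threadLabel_eq hW hi]
    rw [TreeNode.threadLabel_eq (hW.bind h.rigidWord_levelMap)
        (x := i) (by rwa [h.thread_eq hW])]
    cases hμ : W u.length with
    | none => rfl
    | some μ =>
      refine (h.lab_apply i (stage_rank_le_of_firstLevel hW hμ ?_)).symm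
      rw [← length_thread]
      exact hi.length_le
  · rw [if_pos (show u ∈ {u | ¬ ∃ i, u <+: thread W (g i)} from hu), threadLabel, dif_neg]
    rintro ⟨i, hi⟩
    exact hu ⟨i, by rwa [h.thread_eq hW] at hi⟩

end Reduction

/-- The Ramsey theorem for labellings whose classes have minima forming a skew subtree. -/
theorem exists_monochromatic_labelling (k m : ℕ) (C : Type) [Finite C] :
    ∃ n, ∀ c : (Node b → Option (TreeNode b k)) → C,
      ∃ (U : Node b → Option (TreeNode b m)) (f : TreeNode b m → Node b),
        IsSkewEmbedding f ∧ (∀ x y, x.rank < y.rank → (f x).length < (f y).length) ∧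
        (∀ x, U (f x) = some x) ∧ (∀ z x, U z = some x → f x <+: z ∧ z.length < n) ∧
        ∃ i, ∀ (v : TreeNode b m → Option (TreeNode b k)) (g : TreeNode b k → TreeNode b m),
          IsReduction v g → c (fun z => (U z).bind v) = i := by
  obtain ⟨N, hN⟩ := graham_rothschild (Level b k) (Level b m) C
  obtain ⟨n, hn⟩ := Node.exists_offThread_invariant (b := b) (TreeNode b k) C N
  refine ⟨n, fun c => ?_⟩
  obtain ⟨U, f, hmin, hself, hchild, hlen, hdel⟩ := hn c
  -- A word of levels gets the colour of the labelling it describes, carried into the tree by the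
  -- classes `U`.
  obtain ⟨W, hW, hWN, i, hi⟩ := hN fun w => c fun z => (U z).bind (threadLabel w)
  have hthread : ∀ x, (thread W x).length < N := fun x => by
    rw [length_thread]
    exact hWN _ (by rw [firstLevel_spec hW]; exact Option.some_ne_none _)
  have hmono : ∀ u z : Node b, u <+: z → z.length < N → f u <+: f z := by
    rintro u _ ⟨s, rfl⟩ hz
    induction s using List.reverseRecOn with
    | nil => rw [List.append_nil]
    | append_singleton s a ih =>
      rw [← List.append_assoc] at hz ⊢
      exact (ih (by simp at hz ⊢; omega)).trans ((List.prefix_append _ _).trans (hchild _ a hz))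
  have hlen' : ∀ x y : TreeNode b m, x.rank < y.rank →
      (f (thread W x)).length < (f (thread W y)).length := fun x y hxy =>
    hlen _ _ (thread_length_lt hW hxy) (hthread y)
  refine ⟨fun z => (U z).bind (threadLabel W), fun x => f (thread W x),
    ⟨fun x y a hxy => ?_, fun x y hxy => Node.rank_lt_of_length_lt (hlen' x y hxy)⟩, hlen',
    fun x => ?_, fun z x hz => ?_, i, fun v g h => ?_⟩
  · have h1 := thread_child hW hxy
    exact (hchild _ a (h1.length_le.trans_lt (hthread y))).trans (hmono _ _ h1 (hthread y))
  · simp only [hself _ (hthread x), Option.bind_some, threadLabel_thread hW]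
  · obtain ⟨u, hu, hx⟩ := Option.bind_eq_some_iff.1 hz
    obtain ⟨h1, h2, h3⟩ := hmin z u hu
    exact ⟨(hmono _ _ (thread_prefix_of_threadLabel hW hx) h1).trans h2, h3⟩
  · rw [← hi _ h.rigidWord_levelMap]
    have h1 := hdel (fun u => (threadLabel W u).bind v) {u | ¬ ∃ i, u <+: thread W (g i)}
      (fun u hu u' huu' hu' => hu (hu'.imp fun _ => huu'.trans)) (fun u hu _ => ?_)
    · simp only [Option.bind_assoc]
      rw [h1]
      congr 1
      funext z
      congr 1
      funext u
      exact (h.threadLabel_eq hW u).symm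
    · cases hv : (threadLabel W u).bind v with
      | none => exact Or.inl rfl
      | some j =>
        obtain ⟨y, hy, hj⟩ := Option.bind_eq_some_iff.1 hv
        -- A label `j` off the selected threads repeats the one at the place of `g j`, which is a
        -- predecessor and lies on a selected thread.
        refine Or.inr ⟨thread W (g j), ?_, fun h' => h' ⟨j, List.prefix_rfl⟩, ?_⟩
        · exact ((thread_isSkewEmbedding hW).prefix_of_le (h.le_of_eq_some _ _ hj)).trans
            (thread_prefix_of_threadLabel hW hy)
        · rw [threadLabel_thread hW, Option.bind_some, h.apply_eq]

end TreeNode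

/-! ### From labellings to families over complete skew subtrees. -/

namespace TreeNode

variable {b k m n : ℕ}

theorem ncard_lt (x : TreeNode b m) : {y | y < x}.ncard = x.len := by
  have h1 : len '' {y | y < x} = Set.Iio x.len := by
    ext l
    constructor
    · rintro ⟨y, hy, rfl⟩
      have hy : y < x := hy
      exact lt_of_not_ge fun h => hy.ne (TreeNode.ext (hy.le.eq_of_length_le h))
    · intro hl
      have hl' : l < x.seq.length := hl
      refine ⟨x.ofPrefix (x.seq.take l) (List.take_prefix _ _),
        Set.mem_ofPred.2 (lt_of_le_of_ne (List.take_prefix _ _) fun e => ?_), ?_⟩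
      · have := congrArg len e
        simp only [len, ofPrefix, List.length_take] at this
        omega
      · simp only [len, ofPrefix, List.length_take]
        omega
  have h2 : Set.InjOn len {y | y < x} := fun y hy y' hy' e => by
    rcases le_total_of_le (LT.lt.le hy) (LT.lt.le hy') with h | h
    · exact TreeNode.ext (h.eq_of_length e)
    · exact (TreeNode.ext (h.eq_of_length e.symm)).symm
  rw [← h2.ncard_image, h1, Set.ncard_eq_toFinset_card']
  simp

theorem isChain_le (S : Set (TreeNode b n)) (s : TreeNode b n) :
    IsChain (· ≤ ·) {t | t ∈ S ∧ t ≤ s} := fun _ h _ h' _ => le_total_of_le h.2 h'.2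

theorem ncard_le_eq {S : Set (TreeNode b n)} {s : TreeNode b n} (hs : s ∈ S) :
    {t | t ∈ S ∧ t ≤ s}.ncard = heightIn S s + 1 := by
  have : {t | t ∈ S ∧ t ≤ s} = insert s {t | t ∈ S ∧ t < s} := by
    ext t
    simp only [Set.mem_ofPred_eq, Set.mem_insert_iff, le_iff_lt_or_eq]
    constructor
    · rintro ⟨h1, h2 | h2⟩
      · exact Or.inr ⟨h1, h2⟩
      · exact Or.inl h2
    · rintro (rfl | ⟨h1, h2⟩)
      · exact ⟨hs, Or.inr rfl⟩
      · exact ⟨h1, Or.inl h2⟩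
  rw [this, Set.ncard_insert_of_notMem (fun h => lt_irrefl _ h.2) (Set.toFinite _)]
  rfl

theorem ncard_le (x : TreeNode b m) : {y | y ≤ x}.ncard = x.len + 1 := by
  have := ncard_le_eq (Set.mem_univ x)
  simp only [heightIn, Set.mem_univ, true_and] at this
  rw [this, ncard_lt]

section Range

variable {f : TreeNode b m → TreeNode b n} (hf : IsSkewEmbedding fun x => (f x).seq)
include hf

theorem IsSkewEmbedding.le_iff {x y : TreeNode b m} : f x ≤ f y ↔ x ≤ y :=
  ⟨fun h => hf.le_of_prefix h, fun h => hf.prefix_of_le h⟩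

theorem IsSkewEmbedding.injective_of_seq : Injective f := fun _ _ h =>
  le_antisymm (hf.le_iff.1 h.le) (hf.le_iff.1 h.ge)

theorem IsSkewEmbedding.lt_iff {x y : TreeNode b m} : f x < f y ↔ x < y := by
  rw [lt_iff_le_and_ne, lt_iff_le_and_ne, hf.le_iff, hf.injective_of_seq.ne_iff]

theorem IsSkewEmbedding.heightIn_range (x : TreeNode b m) :
    heightIn (Set.range f) (f x) = x.len := by
  have : {t | t ∈ Set.range f ∧ t < f x} = f '' {y | y < x} := by
    ext t
    constructor
    · rintro ⟨⟨y, rfl⟩, hy⟩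
      exact ⟨y, hf.lt_iff.1 hy, rfl⟩
    · rintro ⟨y, hy, rfl⟩
      exact ⟨⟨y, rfl⟩, hf.lt_iff.2 hy⟩
  rw [heightIn, this, Set.ncard_image_of_injective _ hf.injective_of_seq, ncard_lt]

/-- Order and directions transfer along `f`, and lengths increasing along the breadth-first order
give both length conditions. -/
theorem IsSkewEmbedding.isCompleteSkew_range [NeZero b] (hm : 0 < m)
    (hlen : ∀ x y, x.rank < y.rank → (f x).len < (f y).len) :
    IsCompleteSkew m (Set.range f) where
  exists_root := ⟨f ⟨[], hm⟩, ⟨_, rfl⟩, by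
    rintro _ ⟨y, rfl⟩
    exact hf.le_iff.2 (List.nil_prefix : [] <+: y.seq)⟩
  ncard_maxChain C hC := by
    have hne : C.Nonempty := by
      rw [Set.nonempty_iff_ne_empty]
      rintro rfl
      have := hC.2 (y := {f ⟨[], hm⟩}) ⟨by rintro _ rfl; exact ⟨_, rfl⟩,
        IsChain.singleton⟩ (Set.empty_subset _) (Set.mem_singleton _)
      exact this
    obtain ⟨s, hs, hmax⟩ := Set.exists_max_image C len (Set.toFinite _) hne
    obtain ⟨x, rfl⟩ := hC.1.1 hs
    have hCx : ∀ t ∈ C, t ≤ f x := fun t ht => by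
      by_contra h
      rcases hC.1.2.total ht hs with h1 | h1
      · exact h h1
      · exact h (TreeNode.ext (h1.eq_of_length_le (hmax t ht))).ge
    have hx := x.length_lt
    -- Any leaf above the top of `C` will do; by maximality `C` is the whole branch below it.
    obtain ⟨y, hxy, hy⟩ : ∃ y : TreeNode b m, x ≤ y ∧ y.len + 1 = m := by
      refine ⟨⟨x.seq ++ List.replicate (m - 1 - x.seq.length) 0, ?_⟩, List.prefix_append _ _, ?_⟩
      · simp; omega
      · simp only [len, List.length_append, List.length_replicate]; omega
    have h1 : C = f '' {z | z ≤ y} := by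
      refine Set.Subset.antisymm (fun t ht => ?_) (hC.2 ⟨Set.image_subset_range _ _, ?_⟩ ?_)
      · obtain ⟨z, rfl⟩ := hC.1.1 ht
        exact ⟨z, (hf.le_iff.1 (hCx _ ht)).trans hxy, rfl⟩
      · rintro _ ⟨z, hz, rfl⟩ _ ⟨z', hz', rfl⟩ -
        exact (le_total_of_le hz hz').imp hf.le_iff.2 hf.le_iff.2
      · intro t ht
        obtain ⟨z, rfl⟩ := hC.1.1 ht
        exact ⟨z, (hf.le_iff.1 (hCx _ ht)).trans hxy, rfl⟩
    rw [h1, Set.ncard_image_of_injective _ hf.injective_of_seq, ncard_le, hy]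
  len_le_of_lex := by
    rintro _ ⟨x, rfl⟩ _ ⟨y, rfl⟩ hxy hlex
    rw [hf.heightIn_range, hf.heightIn_range] at hxy
    rcases hlex with hle | ⟨p, u, v, i, j, hu, hv, hij⟩
    · exact hle.length_le
    · rcases le_or_le_or_split x y with h1 | h1 | ⟨q, i', j', hne, h1, h2⟩
      · exact (hf.le_iff.2 h1).length_le
      · rw [TreeNode.ext (h1.eq_of_length hxy.symm)]
      · rcases lt_or_gt_of_ne hne with hij' | hij'
        · refine (hlen x y ?_).le
          obtain ⟨u', hu'⟩ := h1
          obtain ⟨v', hv'⟩ := h2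
          unfold rank
          simp only [len, ← hu', ← hv', List.append_assoc, List.singleton_append] at hxy ⊢
          exact Node.rank_lt_of_split hij' (by simpa using hxy)
        · have h3 := Node.lt_of_split hij' (hf.child q y j' h2) (hf.child q x i' h1)
          have h4 : (f x).seq < (f y).seq := Node.lt_of_split (p := p) hij ⟨u, by simp [hu]⟩ ⟨v, by simp [hv]⟩
          exact absurd h3 (not_lt.2 h4.le)
  len_lt_of_height_lt := by
    rintro _ ⟨x, rfl⟩ _ ⟨y, rfl⟩ hxy
    rw [hf.heightIn_range, hf.heightIn_range] at hxy
    exact hlen x y (Node.rank_lt_of_length_lt hxy)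
  existsUnique_immSucc := by
    rintro _ ⟨x, rfl⟩ hx i
    have hlt : x.seq.length + 1 < m := by
      by_contra h
      refine hx ⟨⟨x, rfl⟩, ?_⟩
      rintro _ ⟨y, rfl⟩ hxy
      have := y.length_lt
      exact (congrArg f (TreeNode.ext ((hf.le_iff.1 hxy).eq_of_length_le (by omega)))).ge
    let z : TreeNode b m := ⟨x.seq ++ [i], by simpa using hlt⟩
    have hz : z.seq = x.seq ++ [i] := rfl
    have hxz : x < z := lt_of_child (a := i) List.prefix_rfl
    refine ⟨f z, ⟨⟨⟨z, rfl⟩, hf.lt_iff.2 hxz, ?_⟩, hf.child x z i List.prefix_rfl⟩, ?_⟩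
    · rintro ⟨_, ⟨y, rfl⟩, h1, h2⟩
      obtain ⟨a, ha⟩ := exists_child_of_lt (hf.lt_iff.1 h1)
      obtain ⟨a', ha'⟩ := exists_child_of_lt (hf.lt_iff.1 h2)
      have h3 := ha.length_le
      have h4 := ha'.length_le
      simp [hz] at h3 h4
      omega
    · rintro _ ⟨⟨⟨y, rfl⟩, -, h2⟩, h3⟩
      have hzy : z ≤ y := hf.child_of_prefix h3
      by_contra hne
      exact h2 ⟨f z, ⟨z, rfl⟩, hf.lt_iff.2 hxz, hf.lt_iff.2 (lt_of_le_of_ne hzy fun e =>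
        hne (congrArg f e.symm))⟩

end Range

theorem heightIn_immSucc {S : Set (TreeNode b n)} {s t : TreeNode b n} (hs : s ∈ S)
    (ht : t ∈ immSucc S s) : heightIn S t = heightIn S s + 1 := by
  rw [← ncard_le_eq hs, heightIn]
  congr 1
  ext u
  refine and_congr_right fun hu => ⟨fun h => ?_, fun h => h.trans_lt ht.2.1⟩
  rcases le_total_of_le h.le ht.2.1.le with h1 | h1
  · exact h1
  · by_contra h2
    exact ht.2.2 ⟨u, hu, lt_of_le_of_ne h1 fun e => h2 e.ge, h⟩

theorem heightIn_lt {S : Set (TreeNode b n)} {s t : TreeNode b n} (hs : s ∈ S) (h : s < t) :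
    heightIn S s < heightIn S t := by
  refine Set.ncard_lt_ncard ⟨fun u hu => ⟨hu.1, hu.2.trans h⟩, fun h' => ?_⟩ (Set.toFinite _)
  exact lt_irrefl _ (h' (show s ∈ {u | u ∈ S ∧ u < t} from ⟨hs, h⟩)).2

namespace IsCompleteSkew

variable {S : Set (TreeNode b n)} (hS : IsCompleteSkew k S)

include hS

theorem heightIn_maximal {s : TreeNode b n} (hs : Maximal (· ∈ S) s) : heightIn S s + 1 = k := by
  rw [← ncard_le_eq hs.1]
  refine hS.ncard_maxChain _ ⟨⟨fun _ ht => ht.1, isChain_le S s⟩, fun D hD hle _ ht => ⟨hD.1 ht, ?_⟩⟩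
  rcases hD.2.total ht (hle ⟨hs.1, le_rfl⟩) with h | h
  · exact h
  · exact hs.2 (hD.1 ht) h

theorem heightIn_lt_of_not_maximal {s : TreeNode b n} (hs : s ∈ S) (h : ¬ Maximal (· ∈ S) s) :
    heightIn S s + 1 < k := by
  obtain ⟨t, hst, ht⟩ := (Set.toFinite S).exists_le_maximal hs
  rcases hst.lt_or_eq with h1 | rfl
  · have := heightIn_lt hs h1
    have := hS.heightIn_maximal ht
    omega
  · exact absurd ht h

/-- Following the unique successor in each direction from the root defines `g`, and height in `S`
equals length in `b^{<k}`. Ranks increase across levels by `len_lt_of_height_lt`; within a level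
`len_le_of_lex` gives weakly increasing lengths, and ties are decided lexicographically. -/
theorem exists_isSkewEmbedding : ∃ g : TreeNode b k → TreeNode b n,
    IsSkewEmbedding (fun x => (g x).seq) ∧ Set.range g = S := by
  classical
  obtain ⟨r, hr, hmin⟩ := hS.exists_root
  have hsucc : ∀ (s : TreeNode b n) (a : Fin b), ∃ t, s ∈ S → heightIn S s + 1 < k →
      t ∈ immSucc S s ∧ s.seq ++ [a] <+: t.seq := fun s a => by
    by_cases h : s ∈ S ∧ heightIn S s + 1 < k
    · obtain ⟨t, ht, -⟩ := hS.existsUnique_immSucc s h.1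
        (fun h' => h.2.ne (hS.heightIn_maximal h')) a
      exact ⟨t, fun _ _ => ht⟩
    · exact ⟨s, fun h1 h2 => absurd ⟨h1, h2⟩ h⟩
  choose σ hσ using hsucc
  let G : Node b → TreeNode b n := fun s => s.foldl σ r
  have hG : ∀ s a, G (s ++ [a]) = σ (G s) a := fun s a => by simp [G]
  have hmem : ∀ s : Node b, s.length < k → G s ∈ S ∧ heightIn S (G s) = s.length := by
    intro s
    induction s using List.reverseRecOn with
    | nil =>
      refine fun _ => ⟨hr, ?_⟩
      have : {t | t ∈ S ∧ t < r} = ∅ := Set.eq_empty_of_forall_notMem fun _ ht =>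
        not_le_of_gt ht.2 (hmin ht.1)
      simp [G, heightIn, this]
    | append_singleton s a ih =>
      intro hs
      rw [List.length_append, List.length_singleton] at hs
      obtain ⟨h1, h2⟩ := ih (by omega)
      have h3 := hσ (G s) a h1 (by omega)
      rw [hG, heightIn_immSucc h1 h3.1, h2]
      exact ⟨h3.1.1, by simp⟩
  have hsuccG : ∀ (s : Node b) a, s.length + 1 < k →
      G (s ++ [a]) ∈ immSucc S (G s) ∧ (G s).seq ++ [a] <+: (G (s ++ [a])).seq := fun s a hs => by
    obtain ⟨h1, h2⟩ := hmem s (by omega)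
    rw [hG]
    exact hσ _ a h1 (by omega)
  have hmono : ∀ s u : Node b, (s ++ u).length < k → G s ≤ G (s ++ u) := by
    intro s u
    induction u using List.reverseRecOn with
    | nil => intro _; rw [List.append_nil]
    | append_singleton u a ih =>
      intro h
      rw [← List.append_assoc] at h ⊢
      rw [List.length_append (bs := [a]), List.length_singleton] at h
      exact (ih (by omega)).trans (hsuccG _ a h).1.2.1.le
  have hchild : ∀ (x y : TreeNode b k) a, x.seq ++ [a] <+: y.seq →
      (G x.seq).seq ++ [a] <+: (G y.seq).seq := by
    intro x y a h
    have hlen := h.length_le.trans_lt y.length_lt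
    obtain ⟨u, hu⟩ := h
    rw [List.length_append, List.length_singleton] at hlen
    refine (hsuccG _ a hlen).2.trans ?_
    rw [← hu]
    exact hmono _ u (by rw [hu]; exact y.length_lt)
  refine ⟨fun x => G x.seq, ⟨hchild, fun x y hxy => ?_⟩, ?_⟩
  · obtain ⟨hx1, hx2⟩ := hmem x.seq x.length_lt
    obtain ⟨hy1, hy2⟩ := hmem y.seq y.length_lt
    rcases lt_trichotomy x.seq.length y.seq.length with h | h | h
    · exact Node.rank_lt_of_length_lt (hS.len_lt_of_height_lt _ hx1 _ hy1 (by
        rw [hx2, hy2]; exact h))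
    · rcases le_or_le_or_split x y with h1 | h1 | ⟨p, i, j, hne, h1, h2⟩
      · rw [TreeNode.ext (h1.eq_of_length h)] at hxy
        exact absurd hxy (lt_irrefl _)
      · rw [TreeNode.ext (h1.eq_of_length h.symm)] at hxy
        exact absurd hxy (lt_irrefl _)
      · have hij : i < j := by
          refine lt_of_le_of_ne (not_lt.1 fun hji => ?_) hne
          obtain ⟨u, hu⟩ := h1
          obtain ⟨v, hv⟩ := h2
          unfold rank at hxy
          simp only [← hu, ← hv, List.append_assoc, List.singleton_append] at hxy h
          exact lt_asymm hxy (Node.rank_lt_of_split hji (by simpa using h.symm))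
        obtain ⟨u, hu⟩ := hchild p x i h1
        obtain ⟨v, hv⟩ := hchild p y j h2
        rw [List.append_assoc, List.singleton_append] at hu hv
        have hle := hS.len_le_of_lex _ hx1 _ hy1 (by omega)
          (Or.inr ⟨_, u, v, i, j, hu.symm, hv.symm, hij⟩)
        rcases hle.lt_or_eq with hl | hl
        · exact Node.rank_lt_of_length_lt hl
        · simp only [len, ← hu, ← hv] at hl ⊢
          exact Node.rank_lt_of_split hij (by simpa using hl)
    · exact absurd hxy (lt_asymm (Node.rank_lt_of_length_lt h))
  · ext s
    constructor
    · rintro ⟨x, rfl⟩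
      exact (hmem _ x.length_lt).1
    · intro hs
      have hk : 0 < k := by
        obtain ⟨t, -, ht⟩ := (Set.toFinite S).exists_le_maximal hs
        have := hS.heightIn_maximal ht
        omega
      -- Surjectivity: if the last `G x.seq` below `s` is not `s`, the lowest member of `S` above it
      -- and up to `s` is, by uniqueness of successors, a further value of `G`.
      obtain ⟨x, hx, hmax⟩ := Set.exists_max_image {x : TreeNode b k | G x.seq ≤ s} len
        (Set.toFinite _) ⟨⟨[], hk⟩, hmin hs⟩
      refine ⟨x, ?_⟩
      by_contra hne
      have hlt : G x.seq < s := lt_of_le_of_ne hx hne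
      obtain ⟨h1, h2⟩ := hmem x.seq x.length_lt
      obtain ⟨a, ha⟩ := exists_child_of_lt hlt
      have hnm : ¬ Maximal (· ∈ S) (G x.seq) := fun h => not_lt_of_ge (h.2 hs hx) hlt
      have hxk : x.seq.length + 1 < k := by
        have := hS.heightIn_lt_of_not_maximal h1 hnm
        omega
      obtain ⟨t, ht, htmin⟩ := Set.exists_min_image {t | t ∈ S ∧ G x.seq < t ∧ t ≤ s} rank
        (Set.toFinite _) ⟨s, hs, hlt, le_rfl⟩
      have ht1 : t ∈ immSucc S (G x.seq) := by
        refine ⟨ht.1, ht.2.1, ?_⟩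
        rintro ⟨u, hu, h3, h4⟩
        exact not_lt_of_ge (htmin u ⟨hu, h3, h4.le.trans ht.2.2⟩) (rank_strictMono h4)
      have ht2 : (G x.seq).seq ++ [a] <+: t.seq := by
        obtain ⟨a', ha'⟩ := exists_child_of_lt ht.2.1
        rwa [Node.eq_of_append_prefix ha (ha'.trans ht.2.2)]
      have h5 := (hS.existsUnique_immSucc _ h1 hnm a).unique ⟨ht1, ht2⟩ (hsuccG _ a hxk)
      have h6 := hmax ⟨x.seq ++ [a], by simpa using hxk⟩ (by
        simp only [Set.mem_ofPred_eq]
        rw [← h5]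
        exact ht.2.2)
      simp [len] at h6

end IsCompleteSkew

/-- The classes of a labelling of `b^{<n}`. -/
def labelClasses (n : ℕ) (u : Node b → Option (TreeNode b k)) : Set (Set (TreeNode b n)) :=
  Set.range fun x => {z | u z.seq = some x}

theorem labelClasses_mem_families [NeZero b] (hm : 0 < m) {U : Node b → Option (TreeNode b m)}
    {f : TreeNode b m → TreeNode b n} (hf : IsSkewEmbedding fun x => (f x).seq)
    (hlen : ∀ x y, x.rank < y.rank → (f x).len < (f y).len) (hself : ∀ x, U (f x).seq = some x)
    (hmin : ∀ z x, U z = some x → (f x).seq <+: z) : labelClasses n U ∈ families m b n := by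
  refine ⟨Set.range f, fun t => {z | U z.seq = U t.seq}, hf.isCompleteSkew_range hm hlen, ?_, ?_, ?_⟩
  · rintro _ ⟨x, rfl⟩
    refine ⟨rfl, fun z hz => ?_⟩
    rw [Set.mem_ofPred_eq, hself] at hz
    exact hmin _ _ hz
  · rintro _ ⟨x, rfl⟩ _ ⟨y, rfl⟩ hne
    refine Set.disjoint_left.2 fun z hz hz' => hne ?_
    rw [Set.mem_ofPred_eq, hself] at hz hz'
    rw [Option.some.inj (hz.symm.trans hz')]
  · rw [← Set.range_comp]
    unfold labelClasses
    congr 1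
    funext x
    simp only [Function.comp_apply, hself]

/-- Every class of `U` lies inside one member of the subspace or misses them all. So `v` is read off
at the minima `f y`, and the minimum of a member must be the minimum of some class, which defines
`g`. -/
theorem exists_isReduction_of_mem_subspaces {U : Node b → Option (TreeNode b m)}
    {f : TreeNode b m → TreeNode b n} (hf : IsSkewEmbedding fun x => (f x).seq)
    (hself : ∀ x, U (f x).seq = some x) (hmin : ∀ z x, U z = some x → (f x).seq <+: z)
    {𝒱 : Set (Set (TreeNode b n))} (h𝒱 : 𝒱 ∈ subspaces k (labelClasses n U)) :
    ∃ (v : TreeNode b m → Option (TreeNode b k)) (g : TreeNode b k → TreeNode b m),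
      IsReduction v g ∧ labelClasses n (fun z => (U z).bind v) = 𝒱 := by
  classical
  obtain ⟨⟨T, V, hT, hV, hdisj, rfl⟩, hsub⟩ := h𝒱
  obtain ⟨g₀, hg₀, rfl⟩ := hT.exists_isSkewEmbedding
  have hclass : ∀ x, ∀ z ∈ V (g₀ x), ∃ y, U z.seq = some y ∧
      ∀ z' : TreeNode b n, U z'.seq = some y → z' ∈ V (g₀ x) := by
    intro x z hz
    obtain ⟨𝒜, h𝒜, e⟩ := hsub _ ⟨g₀ x, ⟨x, rfl⟩, rfl⟩
    rw [e] at hz ⊢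
    obtain ⟨A, hA, hzA⟩ := hz
    obtain ⟨y, rfl⟩ := h𝒜 hA
    exact ⟨y, hzA, fun z' hz' => ⟨_, hA, hz'⟩⟩
  have hg : ∀ x, ∃ y, f y = g₀ x := fun x => by
    obtain ⟨y, hy, hy'⟩ := hclass x _ (hV _ ⟨x, rfl⟩).1
    exact ⟨y, le_antisymm (hmin _ _ hy) ((hV _ ⟨x, rfl⟩).2 (hy' _ (hself y)))⟩
  choose g hg using hg
  have hv : ∀ y, ∃ o : Option (TreeNode b k), ∀ x, o = some x ↔ f y ∈ V (g₀ x) := fun y => by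
    by_cases h : ∃ x, f y ∈ V (g₀ x)
    · obtain ⟨x, hx⟩ := h
      refine ⟨some x, fun x' => ⟨fun e => Option.some.inj e ▸ hx, fun hx' => ?_⟩⟩
      by_contra hne
      exact Set.disjoint_left.1 (hdisj ⟨x, rfl⟩ ⟨x', rfl⟩ fun e =>
        hne (congrArg some (hg₀.injective_of_seq e))) hx hx'
    · exact ⟨none, fun x => ⟨fun e => by simp at e, fun hx => absurd ⟨x, hx⟩ h⟩⟩
  choose v hv using hv
  refine ⟨v, g, ⟨⟨fun x y a h => ?_, fun x y h => ?_⟩, fun x => ?_, fun z x h => ?_⟩, ?_⟩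
  · have := hg₀.child x y a h
    simp only [← hg] at this
    exact hf.child_of_prefix this
  · have := hg₀.rank_lt x y h
    simp only [← hg] at this
    exact not_le.1 fun h' => not_le.2 this (hf.rank_le_iff.2 h')
  · rw [hv, hg]
    exact (hV _ ⟨x, rfl⟩).1
  · rw [hv] at h
    have := (hV _ ⟨x, rfl⟩).2 h
    rw [← hg] at this
    exact hf.le_iff.1 this
  · rw [← Set.range_comp]
    unfold labelClasses
    congr 1
    funext x
    ext z
    simp only [Set.mem_ofPred_eq, Option.bind_eq_some_iff, hv, Function.comp_apply]
    constructor
    · rintro ⟨y, hy, hx⟩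
      obtain ⟨y', hy', hall⟩ := hclass x _ hx
      rw [hself] at hy'
      exact hall z (Option.some.inj hy' ▸ hy)
    · intro hz
      obtain ⟨y, hy, hall⟩ := hclass x z hz
      exact ⟨y, hy, hall _ (hself y)⟩

end TreeNode

theorem theorem4 (k m b r : ℕ) (hk : 0 < k) (hm : 0 < m) (hb : 0 < b) (hr : 0 < r)
    (hkm : k ≤ m) :
    ∃ n₀ : ℕ, 0 < n₀ ∧ ∀ n : ℕ, n₀ ≤ n →
      ∀ c : ↥(TreeNode.families k b n) → Fin r,
        ∃ 𝒰 ∈ TreeNode.families m b n, ∃ i : Fin r,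
          ∀ (𝒱 : Set (Set (TreeNode b n))) (h𝒱 : 𝒱 ∈ TreeNode.subspaces k 𝒰),
            c ⟨𝒱, h𝒱.1⟩ = i := by
  classical
  have : NeZero b := ⟨hb.ne'⟩
  obtain ⟨N, hN⟩ := TreeNode.exists_monochromatic_labelling (b := b) k m (Fin r)
  refine ⟨N + 1, N.succ_pos, fun n hn c => ?_⟩
  obtain ⟨U, f, hf, hlen, hself, hmin, i, hi⟩ := hN fun u =>
    -- The default colour is never used: the labellings that come from subspaces do give families.
    if h : TreeNode.labelClasses n u ∈ TreeNode.families k b n then c ⟨_, h⟩ else ⟨0, hr⟩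
  let f' : TreeNode b m → TreeNode b n := fun x =>
    ⟨f x, (hmin _ _ (hself x)).2.trans (Nat.lt_of_succ_le hn)⟩
  have hf' : TreeNode.IsSkewEmbedding fun x => (f' x).seq := hf
  refine ⟨TreeNode.labelClasses n U, TreeNode.labelClasses_mem_families hm hf' hlen hself
    fun z x h => (hmin z x h).1, i, fun 𝒱 h𝒱 => ?_⟩
  obtain ⟨v, g, h, rfl⟩ := TreeNode.exists_isReduction_of_mem_subspaces hf' hself
    (fun z x h => (hmin z x h).1) h𝒱
  rw [← hi v g h, dif_pos h𝒱.1]
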